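/- Let $G$ be a finite group. For a subgroup $L\le G\times G$ write $L^\circ=\{(h,g)\mid (g,h)\in L\}$, and for $L,M\le G\times G$ let $L*M=\{(g,k)\mid \exists h\in G:\ (g,h)\in L,\ (h,k)\in M\}$. A subgroup of $G\times G$ is called twisted diagonal if it is of the form $\Delta(U,\alpha,V)=\{(\alpha(v),v)\mid v\in V\}$ with $U,V\le G$ and $\alpha\colon V\to U$ an isomorphism. Let $\mathcal S$ be a set of twisted diagonal subgroups of $G\times G$ that is closed under $G\times G$-conjugation, under taking subgroups and under $*$, and that contains $\{(g,g)\mid g\in G\}$. Let $B(G,G)$ be the double Burnside ring of $G$, that is, the Grothendieck group of finite $(G,G)$-bisets with multiplication $[X][Y]=[X\times_G Y]$, and let $B^{\mathcal S}(G,G)$ be its unital subring spanned by the classes $[(G\times G)/L]$ with $L\in\mathcal S$. For $L\le G\times G$ let $\Phi_L\colon B(G,G)\to\mathbb Z$ be the homomorphism $[X]\mapsto |X^L|$. Let $\mathcal S_G$ be the category whose objects are the subgroups of $G$ and whose morphisms $V\to U$ are the group homomorphisms $\phi\colon V\to U$ with $\{(\phi(v),v)\mid v\in V\}\in\mathcal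 S$; let $\tilde{\mathcal S}_G$ be a set of representatives of its isomorphism classes of objects. For $U\le G$ put $\mathrm{Out}_{\mathcal S_G}(U)=\mathrm{Aut}_{\mathcal S_G}(U)/\mathrm{Inn}(U)$ and $\overline{\mathrm{Hom}}_{\mathcal S_G}(U,G)=\mathrm{Inn}(G)\backslash\mathrm{Hom}_{\mathcal S_G}(U,G)$, a right $\mathrm{Out}_{\mathcal S_G}(U)$-set by composition. Consider the group homomorphism $$\tilde\sigma\colon B^{\mathcal S}(G,G)\to\bigoplus_{U\in\tilde{\mathcal S}_G}\mathrm{End}_{\mathbb Z\mathrm{Out}_{\mathcal S_G}(U)}\bigl(\mathbb Z\overline{\mathrm{Hom}}_{\mathcal S_G}(U,G)\bigr),$$ $$\tilde\sigma(a)_U([\psi])=\sum_{[\phi]\in\overline{\mathrm{Hom}}_{\mathcal S_G}(U,G)}\frac{\Phi_{\Delta(\phi(U),\phi\psi^{-1},\psi(U))}(a)}{|C_G(\phi(U))|}\,[\phi],$$ and, for a commutative ring $R$, the $R$-module homomorphism $$\tilde\sigma_R\colon R\otimes_{\mathbb Z}B^{\mathcal S}(G,G)\to\bigoplus_{U\in\tilde{\mathcal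 S}_G}\mathrm{End}_{R\mathrm{Out}_{\mathcal S_G}(U)}\bigl(R\,\overline{\mathrm{Hom}}_{\mathcal S_G}(U,G)\bigr)$$ induced by it. **Theorem.** (a) The map $\tilde\sigma$ is an injective ring homomorphism. If moreover $L^\circ\in\mathcal S$ for all $L\in\mathcal S$ (equivalently $\mathcal S^\circ=\mathcal S$), then its image has finite index. (b) If $\mathcal S^\circ=\mathcal S$ and $|G|$ is a unit in $R$, then $\tilde\sigma_R$ is an isomorphism of $R$-algebras. -/

import Mathlib

open CategoryTheory TensorProduct

universe u v

noncomputable section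

/-! ## Bisets

A `(G,H)`-biset is regarded as a left `G × H`-set, through `(g, h) • x = g x h⁻¹`. -/

namespace Biset

variable (G H K L : Type u) [Group G] [Group H] [Group K] [Group L]

/-- `X` and `Y` are isomorphic `(G,H)`-bisets. -/
def Iso (X Y : Type u) [MulAction (G × H) X] [MulAction (G × H) Y] : Prop :=
  ∃ e : X ≃ Y, ∀ (g : G × H) (x : X), e (g • x) = g • e x

variable {G H} in
theorem Iso.symm {X Y : Type u} [MulAction (G × H) X] [MulAction (G × H) Y] :
    Iso G H X Y → Iso G H Y X := by
  rintro ⟨e, he⟩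
  refine ⟨e.symm, fun g y => ?_⟩
  rw [Equiv.symm_apply_eq, he, Equiv.apply_symm_apply]

variable {G H} in
theorem Iso.trans {X Y Z : Type u} [MulAction (G × H) X] [MulAction (G × H) Y]
    [MulAction (G × H) Z] : Iso G H X Y → Iso G H Y Z → Iso G H X Z := by
  rintro ⟨e, he⟩ ⟨f, hf⟩
  exact ⟨e.trans f, fun g x => by simp [he, hf]⟩

/-- The action on a disjoint union. -/
instance sumAction (X Y : Type u) [MulAction (G × H) X] [MulAction (G × H) Y] :
    MulAction (G × H) (X ⊕ Y) where
  smul g := Sum.map (g • ·) (g • ·)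
  one_smul x := by
    change Sum.map _ _ x = x
    cases x <;> simp
  mul_smul g h x := by
    change Sum.map _ _ x = Sum.map _ _ (Sum.map _ _ x)
    cases x <;> simp [mul_smul]

instance emptyAction : MulAction (G × H) PEmpty.{u + 1} where
  smul _ x := x
  one_smul x := x.elim
  mul_smul _ _ x := x.elim

/-- The group `G`, as a `(G,G)`-biset by left and right multiplication. -/
structure Regular where
  val : G

instance regularAction : MulAction (G × G) (Regular G) where
  smul g x := ⟨g.1 * x.val * g.2⁻¹⟩
  one_smul x := by
    change Regular.mk (1 * x.val * 1⁻¹) = x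
    simp
  mul_smul g h x := by
    change Regular.mk ((g.1 * h.1) * x.val * (g.2 * h.2)⁻¹) =
      Regular.mk (g.1 * (h.1 * x.val * h.2⁻¹) * g.2⁻¹)
    simp [mul_assoc]

instance [Finite G] : Finite (Regular G) :=
  Finite.of_injective Regular.val (by rintro ⟨a⟩ ⟨b⟩ h; exact congrArg Regular.mk h)

section Tensor

variable (X Y : Type u) [MulAction (G × H) X] [MulAction (H × K) Y]

/-- The orbit relation on `X × Y` of the `H`-action `h (x, y) = (x h⁻¹, h y)`. -/
def tensorSetoid : Setoid (X × Y) where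
  r p q := ∃ h : H, q.1 = ((1, h) : G × H) • p.1 ∧ q.2 = ((h, 1) : H × K) • p.2
  iseqv := by
    refine ⟨fun p => ⟨1, ?_⟩, ?_, ?_⟩
    · simp [← Prod.one_eq_mk]
    · rintro ⟨p1, p2⟩ ⟨q1, q2⟩ ⟨h, h1, h2⟩
      exact ⟨h⁻¹, by simp_all [smul_smul, ← Prod.one_eq_mk]⟩
    · rintro ⟨p1, p2⟩ ⟨q1, q2⟩ ⟨r1, r2⟩ ⟨h, h1, h2⟩ ⟨k, h3, h4⟩
      exact ⟨k * h, by simp_all [smul_smul]⟩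

/-- The set `X ×_H Y` of `H`-orbits of `X × Y`. -/
def Tensor : Type u := Quotient (tensorSetoid G H K X Y)

instance [Finite X] [Finite Y] : Finite (Tensor G H K X Y) :=
  inferInstanceAs (Finite (Quotient (tensorSetoid G H K X Y)))

variable {X Y}

/-- The orbit `x ×_H y`. -/
def tmk (x : X) (y : Y) : Tensor G H K X Y := Quotient.mk (tensorSetoid G H K X Y) (x, y)

variable {G H K}

theorem tmk_eq_iff {x x' : X} {y y' : Y} : tmk G H K x y = tmk G H K x' y' ↔
    ∃ h : H, x' = ((1, h) : G × H) • x ∧ y' = ((h, 1) : H × K) • y :=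
  Quotient.eq (r := tensorSetoid G H K X Y)

@[elab_as_elim]
theorem tensor_ind {P : Tensor G H K X Y → Prop} (t : Tensor G H K X Y)
    (h : ∀ x y, P (tmk G H K x y)) : P t :=
  Quotient.ind (fun p => h p.1 p.2) t

/-- A function on `X ×_H Y` from an `H`-balanced function on `X × Y`. -/
def tlift {T : Type u} (f : X → Y → T)
    (hf : ∀ (h : H) x y, f (((1, h) : G × H) • x) (((h, 1) : H × K) • y) = f x y) :
    Tensor G H K X Y → T :=
  Quotient.lift (fun p => f p.1 p.2) (by
    rintro ⟨p1, p2⟩ ⟨q1, q2⟩ ⟨h, h1, h2⟩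
    dsimp only at h1 h2
    subst h1 h2
    exact (hf h p1 p2).symm)

@[simp] theorem tlift_tmk {T : Type u} (f : X → Y → T) (hf) (x : X) (y : Y) :
    tlift (G := G) (H := H) (K := K) f hf (tmk G H K x y) = f x y := rfl

/-- `g (x ×_H y) k = (g x) ×_H (y k)`. -/
instance tensorAction : MulAction (G × K) (Tensor G H K X Y) where
  smul g := tlift (fun x y => tmk G H K (((g.1, 1) : G × H) • x) (((1, g.2) : H × K) • y)) (by
    intro h x y
    symm
    rw [tmk_eq_iff]
    exact ⟨h, by simp [smul_smul]⟩)
  one_smul t := by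
    induction t using tensor_ind with | h x y =>
    change tmk G H K ((1 : G × H) • x) ((1 : H × K) • y) = _
    simp
  mul_smul g h t := by
    induction t using tensor_ind with | h x y =>
    change tmk G H K _ _ = tmk G H K _ _
    simp [smul_smul]

theorem smul_tmk (g : G × K) (x : X) (y : Y) :
    g • tmk G H K x y = tmk G H K (((g.1, 1) : G × H) • x) (((1, g.2) : H × K) • y) := rfl

end Tensor

variable {G H K L}

theorem Iso.of_bijective {X Y : Type u} [MulAction (G × H) X] [MulAction (G × H) Y] (f : X → Y)
    (h1 : Function.Injective f) (h2 : Function.Surjective f)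
    (he : ∀ (g : G × H) x, f (g • x) = g • f x) : Iso G H X Y :=
  ⟨Equiv.ofBijective f ⟨h1, h2⟩, he⟩

section

variable (X X' Z Z' : Type u) [MulAction (G × H) X] [MulAction (G × H) X']
  [MulAction (G × H) Z] [MulAction (G × H) Z'] (Y Y' : Type u) [MulAction (H × K) Y]
  [MulAction (H × K) Y']

variable {X X' Z Z'} in
theorem sum_congr : Iso G H X X' → Iso G H Z Z' → Iso G H (X ⊕ Z) (X' ⊕ Z') := by
  rintro ⟨e, he⟩ ⟨f, hf⟩
  refine ⟨Equiv.sumCongr e f, ?_⟩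
  rintro g (x | y)
  · exact congrArg Sum.inl (he g x)
  · exact congrArg Sum.inr (hf g y)

theorem sum_comm : Iso G H (X ⊕ Z) (Z ⊕ X) :=
  ⟨Equiv.sumComm _ _, by rintro g (x | y) <;> rfl⟩

theorem sum_assoc : Iso G H ((X ⊕ X') ⊕ Z) (X ⊕ (X' ⊕ Z)) :=
  ⟨Equiv.sumAssoc _ _ _, by rintro g ((x | y) | z) <;> rfl⟩

theorem empty_sum : Iso G H (PEmpty.{u + 1} ⊕ X) X :=
  ⟨Equiv.emptySum _ _, by rintro g (x | y); exacts [x.elim, rfl]⟩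

variable {X X' Y Y'} in
theorem tensor_congr : Iso G H X X' → Iso H K Y Y' →
    Iso G K (Tensor G H K X Y) (Tensor G H K X' Y') := by
  rintro ⟨e, he⟩ ⟨f, hf⟩
  refine Iso.of_bijective (tlift (fun x y => tmk G H K (e x) (f y)) ?_) ?_ ?_ ?_
  · intro h x y
    symm
    rw [tmk_eq_iff]
    exact ⟨h, he _ _, hf _ _⟩
  · intro s t
    induction s using tensor_ind with | h x y =>
    induction t using tensor_ind with | h x' y' =>
    simp only [tlift_tmk]
    rw [tmk_eq_iff, tmk_eq_iff]
    rintro ⟨h, h1, h2⟩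
    exact ⟨h, e.injective (by rw [h1, he]), f.injective (by rw [h2, hf])⟩
  · intro t
    induction t using tensor_ind with | h x' y' =>
    exact ⟨tmk G H K (e.symm x') (f.symm y'), by simp⟩
  · intro g t
    induction t using tensor_ind with | h x y =>
    simp [he, hf, smul_tmk]

theorem tensor_assoc (Z : Type u) [MulAction (K × L) Z] :
    Iso G L (Tensor G K L (Tensor G H K X Y) Z) (Tensor G H L X (Tensor H K L Y Z)) := by
  have key : ∀ (z : Z) (h : H) (x : X) (y : Y),
      tmk G H L (((1, h) : G × H) • x) (tmk H K L (((h, 1) : H × K) • y) z) =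
      tmk G H L x (tmk H K L y z) := by
    intro z h x y
    symm
    rw [tmk_eq_iff]
    exact ⟨h, rfl, by simp [smul_tmk, ← Prod.one_eq_mk]⟩
  refine Iso.of_bijective (tlift (fun s z => tlift (fun x y =>
      tmk G H L x (tmk H K L y z)) (key z) s) ?_) ?_ ?_ ?_
  · intro k s z
    induction s using tensor_ind with | h x y =>
    simp only [smul_tmk, tlift_tmk, ← Prod.one_eq_mk, one_smul]
    congr 1
    symm
    rw [tmk_eq_iff]
    exact ⟨k, rfl, rfl⟩
  · intro s t
    induction s using tensor_ind with | h s z =>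
    induction s using tensor_ind with | h x y =>
    induction t using tensor_ind with | h t z' =>
    induction t using tensor_ind with | h x' y' =>
    simp only [tlift_tmk]
    rw [tmk_eq_iff, tmk_eq_iff]
    rintro ⟨h, h1, h2⟩
    rw [smul_tmk, eq_comm, tmk_eq_iff] at h2
    obtain ⟨k, h3, h4⟩ := h2
    refine ⟨k, ?_, by simpa [← Prod.one_eq_mk] using h4⟩
    rw [smul_tmk, eq_comm, tmk_eq_iff]
    exact ⟨h, by simp [h1, ← Prod.one_eq_mk], by simp [h3, smul_smul]⟩
  · intro t
    induction t using tensor_ind with | h x s =>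
    induction s using tensor_ind with | h y z =>
    exact ⟨tmk G K L (tmk G H K x y) z, rfl⟩
  · intro g t
    induction t using tensor_ind with | h s z =>
    induction s using tensor_ind with | h x y =>
    simp [smul_tmk, ← Prod.one_eq_mk]

theorem regular_smul (g : G × G) (x : G) :
    g • (Regular.mk x) = Regular.mk (g.1 * x * g.2⁻¹) := rfl

theorem regular_tensor : Iso G H (Tensor G G H (Regular G) X) X := by
  refine Iso.of_bijective (tlift (fun a x => ((a.val, 1) : G × H) • x) ?_) ?_ ?_ ?_
  · rintro h ⟨a⟩ x
    simp [smul_smul, regular_smul]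
  · intro s t
    induction s using tensor_ind with | h a x =>
    induction t using tensor_ind with | h b y =>
    obtain ⟨a⟩ := a
    obtain ⟨b⟩ := b
    simp only [tlift_tmk]
    intro h
    rw [tmk_eq_iff]
    refine ⟨b⁻¹ * a, by simp [regular_smul], ?_⟩
    have : y = ((b, 1) : G × H)⁻¹ • ((a, 1) : G × H) • x := by rw [h, inv_smul_smul]
    rw [this, smul_smul]
    simp
  · intro x
    exact ⟨tmk G G H (Regular.mk 1) x, one_smul (G × H) x⟩
  · intro g t
    induction t using tensor_ind with | h a x =>
    obtain ⟨a⟩ := a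
    simp [smul_tmk, smul_smul, Prod.mul_def, regular_smul]

theorem tensor_regular : Iso G H (Tensor G H H X (Regular H)) X := by
  refine Iso.of_bijective (tlift (fun x a => ((1, a.val⁻¹) : G × H) • x) ?_) ?_ ?_ ?_
  · rintro h x ⟨a⟩
    simp [smul_smul, regular_smul]
  · intro s t
    induction s using tensor_ind with | h x a =>
    induction t using tensor_ind with | h y b =>
    obtain ⟨a⟩ := a
    obtain ⟨b⟩ := b
    simp only [tlift_tmk]
    intro h
    rw [tmk_eq_iff]
    refine ⟨b * a⁻¹, ?_, by simp [regular_smul]⟩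
    have : y = ((1, b⁻¹) : G × H)⁻¹ • ((1, a⁻¹) : G × H) • x := by rw [h, inv_smul_smul]
    rw [this, smul_smul]
    simp
  · intro x
    exact ⟨tmk G H H x (Regular.mk 1), by simp [← Prod.one_eq_mk]⟩
  · intro g t
    induction t using tensor_ind with | h x a =>
    obtain ⟨a⟩ := a
    simp [smul_tmk, smul_smul, Prod.mul_def, regular_smul]

theorem sum_tensor :
    Iso G K (Tensor G H K (X ⊕ X') Y) (Tensor G H K X Y ⊕ Tensor G H K X' Y) := by
  refine Iso.of_bijective (tlift (fun s y => Sum.elim (fun x => Sum.inl (tmk G H K x y))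
      (fun x => Sum.inr (tmk G H K x y)) s) ?_) ?_ ?_ ?_
  · rintro h (x | x) y
    · exact congrArg Sum.inl (tmk_eq_iff.2 ⟨h, rfl, rfl⟩).symm
    · exact congrArg Sum.inr (tmk_eq_iff.2 ⟨h, rfl, rfl⟩).symm
  · intro s t
    induction s using tensor_ind with | h s y =>
    induction t using tensor_ind with | h t y' =>
    rcases s with x | x <;> rcases t with x' | x' <;> simp only [tlift_tmk, Sum.elim_inl,
      Sum.elim_inr, Sum.inl.injEq, Sum.inr.injEq, reduceCtorEq, false_imp_iff]
    · rw [tmk_eq_iff, tmk_eq_iff]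
      rintro ⟨h, h1, h2⟩
      exact ⟨h, congrArg Sum.inl h1, h2⟩
    · rw [tmk_eq_iff, tmk_eq_iff]
      rintro ⟨h, h1, h2⟩
      exact ⟨h, congrArg Sum.inr h1, h2⟩
  · rintro (t | t)
    · induction t using tensor_ind with | h x y =>
      exact ⟨tmk G H K (Sum.inl x) y, rfl⟩
    · induction t using tensor_ind with | h x y =>
      exact ⟨tmk G H K (Sum.inr x) y, rfl⟩
  · intro g t
    induction t using tensor_ind with | h s y =>
    rcases s with x | x <;> rfl

theorem tensor_sum :
    Iso G K (Tensor G H K X (Y ⊕ Y')) (Tensor G H K X Y ⊕ Tensor G H K X Y') := by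
  refine Iso.of_bijective (tlift (fun x s => Sum.elim (fun y => Sum.inl (tmk G H K x y))
      (fun y => Sum.inr (tmk G H K x y)) s) ?_) ?_ ?_ ?_
  · rintro h x (y | y)
    · exact congrArg Sum.inl (tmk_eq_iff.2 ⟨h, rfl, rfl⟩).symm
    · exact congrArg Sum.inr (tmk_eq_iff.2 ⟨h, rfl, rfl⟩).symm
  · intro s t
    induction s using tensor_ind with | h x s =>
    induction t using tensor_ind with | h x' t =>
    rcases s with y | y <;> rcases t with y' | y' <;> simp only [tlift_tmk, Sum.elim_inl,
      Sum.elim_inr, Sum.inl.injEq, Sum.inr.injEq, reduceCtorEq, false_imp_iff]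
    · rw [tmk_eq_iff, tmk_eq_iff]
      rintro ⟨h, h1, h2⟩
      exact ⟨h, h1, congrArg Sum.inl h2⟩
    · rw [tmk_eq_iff, tmk_eq_iff]
      rintro ⟨h, h1, h2⟩
      exact ⟨h, h1, congrArg Sum.inr h2⟩
  · rintro (t | t)
    · induction t using tensor_ind with | h x y =>
      exact ⟨tmk G H K x (Sum.inl y), rfl⟩
    · induction t using tensor_ind with | h x y =>
      exact ⟨tmk G H K x (Sum.inr y), rfl⟩
  · intro g t
    induction t using tensor_ind with | h x s =>
    rcases s with y | y <;> rfl

theorem empty_tensor : Iso G K (Tensor G H K PEmpty.{u + 1} Y) PEmpty.{u + 1} := by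
  refine Iso.of_bijective (tlift (fun x _ => x) (fun _ x => x.elim)) ?_ (fun x => x.elim) ?_
  · intro s
    induction s using tensor_ind with | h x y => exact x.elim
  · intro g s
    induction s using tensor_ind with | h x y => exact x.elim

theorem tensor_empty : Iso G K (Tensor G H K X PEmpty.{u + 1}) PEmpty.{u + 1} := by
  refine Iso.of_bijective (tlift (fun _ y => y) (fun _ _ y => y.elim)) ?_ (fun x => x.elim) ?_
  · intro s
    induction s using tensor_ind with | h x y => exact y.elim
  · intro g s
    induction s using tensor_ind with | h x y => exact y.elim

end

end Biset

/-- A finite `(G,G)`-biset, as a finite left `G × G`-set with `(g, h) • x = g x h⁻¹`. -/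
structure FinBiset (G : Type u) [Group G] where
  carrier : Type u
  [act : MulAction (G × G) carrier]
  [fin : Finite carrier]

attribute [instance] FinBiset.act FinBiset.fin

instance FinBiset.setoid (G : Type u) [Group G] : Setoid (FinBiset G) where
  r X Y := Biset.Iso G G X.carrier Y.carrier
  iseqv := ⟨fun _ => ⟨Equiv.refl _, fun _ _ => rfl⟩, Biset.Iso.symm, Biset.Iso.trans⟩

/-! ## The double Burnside ring -/

/-- Isomorphism classes of finite `(G,G)`-bisets. -/
def BisetClass (G : Type u) [Group G] : Type (u + 1) := Quotient (FinBiset.setoid G)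

namespace BisetClass

variable {G : Type u} [Group G]

/-- The isomorphism class of a finite `(G,G)`-biset. -/
def mk (X : Type u) [MulAction (G × G) X] [Finite X] : BisetClass G :=
  Quotient.mk (FinBiset.setoid G) ⟨X⟩

theorem mk_eq_iff {X Y : Type u} [MulAction (G × G) X] [Finite X] [MulAction (G × G) Y]
    [Finite Y] : (mk X : BisetClass G) = mk Y ↔ Biset.Iso G G X Y :=
  Quotient.eq (r := FinBiset.setoid G)

@[elab_as_elim]
theorem ind {P : BisetClass G → Prop} (c : BisetClass G)
    (h : ∀ (X : Type u) [MulAction (G × G) X] [Finite X], P (mk X)) : P c :=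
  Quotient.ind (fun X => h X.carrier) c

/-- Disjoint union. -/
instance : Add (BisetClass G) where
  add := Quotient.map₂ (fun X Y => ⟨X.carrier ⊕ Y.carrier⟩)
    (fun _ _ h _ _ h' => Biset.sum_congr h h')

/-- The class of the empty biset. -/
instance : Zero (BisetClass G) where
  zero := mk PEmpty.{u + 1}

/-- The tensor product `X ×_G Y`. -/
instance : Mul (BisetClass G) where
  mul := Quotient.map₂ (fun X Y => ⟨Biset.Tensor G G G X.carrier Y.carrier⟩)
    (fun _ _ h _ _ h' => Biset.tensor_congr h h')

/-- The class of the biset `G`. -/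
instance [Finite G] : One (BisetClass G) where
  one := mk (Biset.Regular G)

section
variable (X Y : Type u) [MulAction (G × G) X] [Finite X] [MulAction (G × G) Y] [Finite Y]

theorem mk_add_mk : (mk X + mk Y : BisetClass G) = mk (X ⊕ Y) := rfl

theorem mk_mul_mk : (mk X * mk Y : BisetClass G) = mk (Biset.Tensor G G G X Y) := rfl

theorem zero_def : (0 : BisetClass G) = mk PEmpty.{u + 1} := rfl

theorem one_def [Finite G] : (1 : BisetClass G) = mk (Biset.Regular G) := rfl

end

instance [Finite G] : Semiring (BisetClass G) where
  nsmul := nsmulRec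
  add_assoc a b c := by
    induction a using ind; induction b using ind; induction c using ind
    exact mk_eq_iff.2 (Biset.sum_assoc _ _ _)
  add_comm a b := by
    induction a using ind; induction b using ind
    exact mk_eq_iff.2 (Biset.sum_comm _ _)
  zero_add a := by
    induction a using ind
    exact mk_eq_iff.2 (Biset.empty_sum _)
  add_zero a := by
    induction a using ind
    exact mk_eq_iff.2 ((Biset.sum_comm _ _).trans (Biset.empty_sum _))
  mul_assoc a b c := by
    induction a using ind; induction b using ind; induction c using ind
    exact mk_eq_iff.2 (Biset.tensor_assoc _ _ _)
  one_mul a := by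
    induction a using ind
    exact mk_eq_iff.2 (Biset.regular_tensor _)
  mul_one a := by
    induction a using ind
    exact mk_eq_iff.2 (Biset.tensor_regular _)
  left_distrib a b c := by
    induction a using ind; induction b using ind; induction c using ind
    exact mk_eq_iff.2 (Biset.tensor_sum _ _ _)
  right_distrib a b c := by
    induction a using ind; induction b using ind; induction c using ind
    exact mk_eq_iff.2 (Biset.sum_tensor _ _ _)
  zero_mul a := by
    induction a using ind
    exact mk_eq_iff.2 (Biset.empty_tensor _)
  mul_zero a := by
    induction a using ind
    exact mk_eq_iff.2 (Biset.tensor_empty _)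

end BisetClass

/-- The double Burnside group `B(G,G)`: the Grothendieck group of finite `(G,G)`-bisets with
respect to disjoint unions. -/
def DoubleBurnside (G : Type u) [Group G] [Finite G] : Type (u + 1) :=
  Algebra.GrothendieckAddGroup (BisetClass G)

namespace DoubleBurnside

variable {G : Type u} [Group G] [Finite G]

instance : AddCommGroup (DoubleBurnside G) :=
  inferInstanceAs (AddCommGroup (Algebra.GrothendieckAddGroup (BisetClass G)))

/-- The canonical map from isomorphism classes to the Grothendieck group. -/
def of : BisetClass G →+ DoubleBurnside G := Algebra.GrothendieckAddGroup.of

/-- The universal property of the Grothendieck group. -/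
def lift {A : Type*} [AddCommGroup A] (f : BisetClass G →+ A) : DoubleBurnside G →+ A :=
  Algebra.GrothendieckAddGroup.lift f

@[simp] theorem lift_of {A : Type*} [AddCommGroup A] (f : BisetClass G →+ A) (x : BisetClass G) :
    lift f (of x) = f x :=
  DFunLike.congr_fun (Algebra.GrothendieckAddGroup.lift.symm_apply_apply f) x

theorem hom_ext {A : Type*} [AddCommGroup A] {f g : DoubleBurnside G →+ A}
    (h : ∀ x, f (of x) = g (of x)) : f = g :=
  Algebra.GrothendieckAddGroup.lift.symm.injective (AddMonoidHom.ext h)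

/-- The biadditive multiplication induced by the tensor product of bisets. -/
def mulHom : DoubleBurnside G →+ DoubleBurnside G →+ DoubleBurnside G :=
  lift (A := DoubleBurnside G →+ DoubleBurnside G)
    { toFun := fun x => lift (of.comp (AddMonoidHom.mulLeft x))
      map_zero' := hom_ext fun y => by simp
      map_add' := fun x x' => hom_ext fun y => by simp [add_mul] }

@[simp] theorem mulHom_of (x y : BisetClass G) : mulHom (of x) (of y) = of (x * y) := by
  simp [mulHom]

theorem ext_of {A : Type*} [AddCommGroup A] {f g : DoubleBurnside G →+ A}
    (h : ∀ x, f (of x) = g (of x)) (a : DoubleBurnside G) : f a = g a :=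
  DFunLike.congr_fun (hom_ext h) a

instance : Mul (DoubleBurnside G) where
  mul a b := mulHom a b

instance : One (DoubleBurnside G) where
  one := of 1

theorem mul_def (a b : DoubleBurnside G) : a * b = mulHom a b := rfl

theorem of_mul (x y : BisetClass G) : of (x * y) = of x * of y := (mulHom_of x y).symm

theorem one_def : (1 : DoubleBurnside G) = of 1 := rfl

theorem mulHom_one_left (a : DoubleBurnside G) : mulHom (of 1) a = a :=
  ext_of (f := mulHom (of 1)) (g := AddMonoidHom.id _)
    (fun x => by rw [mulHom_of, one_mul, AddMonoidHom.id_apply]) a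

theorem mulHom_one_right (a : DoubleBurnside G) : mulHom a (of 1) = a := by
  have h := ext_of (f := mulHom.flip (of 1)) (g := AddMonoidHom.id (DoubleBurnside G))
    (fun x => by rw [AddMonoidHom.flip_apply, mulHom_of, mul_one, AddMonoidHom.id_apply]) a
  rwa [AddMonoidHom.flip_apply, AddMonoidHom.id_apply] at h

theorem mulHom_assoc (a b c : DoubleBurnside G) :
    mulHom (mulHom a b) c = mulHom a (mulHom b c) := by
  have h1 : ∀ (x y : BisetClass G) (c : DoubleBurnside G),
      mulHom (mulHom (of x) (of y)) c = mulHom (of x) (mulHom (of y) c) := fun x y c => by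
    have h := ext_of (f := mulHom (mulHom (of x) (of y)))
      (g := (mulHom (of x)).comp (mulHom (of y))) (fun z => by
        rw [AddMonoidHom.comp_apply, mulHom_of, mulHom_of, mulHom_of, mulHom_of, mul_assoc]) c
    rwa [AddMonoidHom.comp_apply] at h
  have h2 : ∀ (x : BisetClass G) (b : DoubleBurnside G),
      mulHom (mulHom (of x) b) c = mulHom (of x) (mulHom b c) := fun x b => by
    have h := ext_of (f := (mulHom.flip c).comp (mulHom (of x)))
      (g := (mulHom (of x)).comp (mulHom.flip c)) (fun y => by
        rw [AddMonoidHom.comp_apply, AddMonoidHom.comp_apply, AddMonoidHom.flip_apply,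
          AddMonoidHom.flip_apply, h1]) b
    rwa [AddMonoidHom.comp_apply, AddMonoidHom.comp_apply, AddMonoidHom.flip_apply,
      AddMonoidHom.flip_apply] at h
  have h := ext_of (f := (mulHom.flip c).comp (mulHom.flip b))
    (g := mulHom.flip (mulHom b c)) (fun x => by
      rw [AddMonoidHom.comp_apply, AddMonoidHom.flip_apply, AddMonoidHom.flip_apply,
        AddMonoidHom.flip_apply, h2]) a
  rwa [AddMonoidHom.comp_apply, AddMonoidHom.flip_apply, AddMonoidHom.flip_apply,
    AddMonoidHom.flip_apply] at h

/-- The double Burnside ring. -/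
instance : Ring (DoubleBurnside G) :=
  { (inferInstance : AddCommGroup (DoubleBurnside G)),
    (inferInstance : Mul (DoubleBurnside G)),
    (inferInstance : One (DoubleBurnside G)) with
    left_distrib := fun a b c => (mulHom a).map_add b c
    right_distrib := fun a b c => by
      rw [mul_def, map_add, AddMonoidHom.add_apply]; rfl
    zero_mul := fun a => by rw [mul_def, map_zero, AddMonoidHom.zero_apply]
    mul_zero := fun a => (mulHom a).map_zero
    one_mul := mulHom_one_left
    mul_one := mulHom_one_right
    mul_assoc := mulHom_assoc }

/-- The element `[X]` of `B(G,G)`. -/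
def cls (X : Type u) [MulAction (G × G) X] [Finite X] : DoubleBurnside G :=
  of (BisetClass.mk X)

end DoubleBurnside

/-! ## Subgroups of `G × G` -/

section Subgroups

variable {G : Type u} [Group G]

/-- The twisted diagonal subgroup `Δ(U, α, V) = {(α v, v) | v ∈ V}`. -/
def twistedDiagonal {U V : Subgroup G} (α : V ≃* U) : Subgroup (G × G) :=
  ((U.subtype.comp α.toMonoidHom).prod V.subtype).range

/-- The composition `L * M` of subgroups regarded as relations. -/
def starProduct (L M : Subgroup (G × G)) : Subgroup (G × G) where
  carrier := {x | ∃ h : G, (x.1, h) ∈ L ∧ (h, x.2) ∈ M}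
  mul_mem' := by
    rintro ⟨a, b⟩ ⟨c, d⟩ ⟨h, h1, h2⟩ ⟨k, h3, h4⟩
    exact ⟨h * k, L.mul_mem h1 h3, M.mul_mem h2 h4⟩
  one_mem' := ⟨1, L.one_mem, M.one_mem⟩
  inv_mem' := by
    rintro ⟨a, b⟩ ⟨h, h1, h2⟩
    exact ⟨h⁻¹, L.inv_mem h1, M.inv_mem h2⟩

/-- The opposite subgroup `L° = {(h, g) | (g, h) ∈ L}`. -/
def oppositeSubgroup (L : Subgroup (G × G)) : Subgroup (G × G) :=
  L.map (MulEquiv.prodComm (M := G) (N := G)).toMonoidHom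

/-- The diagonal `Δ(G) = {(g, g) | g ∈ G}`. -/
def diagonalSubgroup (G : Type u) [Group G] : Subgroup (G × G) :=
  ((MonoidHom.id G).prod (MonoidHom.id G)).range

/-- For homomorphisms `φ, ψ : U → G` with `ψ` injective, the subgroup
`{(φ u, ψ u) | u ∈ U} = Δ(φ(U), φ ψ⁻¹, ψ(U))`. -/
def pairSubgroup {U : Type u} [Group U] (φ ψ : U →* G) : Subgroup (G × G) := (φ.prod ψ).range

end Subgroups

/-- A set `S` of twisted diagonal subgroups of `G × G` that is closed under conjugation, under
taking subgroups and under composition and contains the diagonal of `G`. -/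
structure DiagonalSystem (G : Type u) [Group G] where
  carrier : Set (Subgroup (G × G))
  twisted : ∀ L ∈ carrier, ∃ (U V : Subgroup G) (α : V ≃* U), L = twistedDiagonal α
  conj_mem : ∀ L ∈ carrier, ∀ x : G × G, L.map (MulAut.conj x).toMonoidHom ∈ carrier
  subgroup_mem : ∀ L ∈ carrier, ∀ M ≤ L, M ∈ carrier
  star_mem : ∀ L ∈ carrier, ∀ M ∈ carrier, starProduct L M ∈ carrier
  diagonal_mem : diagonalSubgroup G ∈ carrier

namespace DiagonalSystem

variable {G : Type u} [Group G]

/-- The condition `S° = S`. -/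
def IsSymmetric (S : DiagonalSystem G) : Prop := oppositeSubgroup '' S.carrier = S.carrier

theorem eq_one_of_mem (S : DiagonalSystem G) {L : Subgroup (G × G)} (hL : L ∈ S.carrier) {g : G}
    (hg : (g, 1) ∈ L) : g = 1 := by
  obtain ⟨U, V, α, rfl⟩ := S.twisted L hL
  obtain ⟨v, hv⟩ := hg
  rw [Prod.ext_iff] at hv
  obtain ⟨h1, h2⟩ := hv
  change ((α v : U) : G) = g at h1
  have : v = 1 := Subtype.ext h2
  rw [← h1, this, map_one]
  rfl

end DiagonalSystem

/-! ## The ring `B^S(G,G)` -/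

set_option linter.unusedSectionVars false

namespace DoubleBurnside

variable {G : Type u} [Group G] [Finite G]

/-- The subgroup of `B(G,G)` spanned by the elements `[G × G / L]` with `L ∈ S`. -/
def span (S : DiagonalSystem G) : AddSubgroup (DoubleBurnside G) :=
  AddSubgroup.closure {a | ∃ L ∈ S.carrier, a = cls ((G × G) ⧸ L)}

theorem cls_eq_of_iso {X Y : Type u} [MulAction (G × G) X] [Finite X] [MulAction (G × G) Y]
    [Finite Y] (h : Biset.Iso G G X Y) : (cls X : DoubleBurnside G) = cls Y :=
  congrArg of (BisetClass.mk_eq_iff.2 h)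

theorem cls_sum (X Y : Type u) [MulAction (G × G) X] [Finite X] [MulAction (G × G) Y]
    [Finite Y] : (cls (X ⊕ Y) : DoubleBurnside G) = cls X + cls Y := by
  rw [cls, ← BisetClass.mk_add_mk, map_add]; rfl

theorem cls_tensor (X Y : Type u) [MulAction (G × G) X] [Finite X] [MulAction (G × G) Y]
    [Finite Y] : (cls (Biset.Tensor G G G X Y) : DoubleBurnside G) = cls X * cls Y := by
  rw [cls, ← BisetClass.mk_mul_mk, of_mul]; rfl

/-- A biset whose point stabilizers lie in `S` defines an element of the span. -/
theorem cls_mem_span (S : DiagonalSystem G) : ∀ (n : ℕ) (X : Type u) [MulAction (G × G) X]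
    [Finite X], Nat.card X = n → (∀ x : X, MulAction.stabilizer (G × G) x ∈ S.carrier) →
    cls X ∈ span S := by
  intro n
  induction n using Nat.strong_induction_on with
  | _ n ih =>
  intro X _ _ hn hX
  rcases isEmpty_or_nonempty X with hE | ⟨⟨x⟩⟩
  · have h0 : (cls X : DoubleBurnside G) = 0 := by
      have : (BisetClass.mk X : BisetClass G) = BisetClass.mk PEmpty.{u + 1} :=
        BisetClass.mk_eq_iff.2 ⟨Equiv.equivOfIsEmpty _ _, fun _ x => isEmptyElim x⟩
      rw [cls, this, ← BisetClass.zero_def, map_zero]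
    rw [h0]
    exact zero_mem _
  · let O : SubMulAction (G × G) X :=
      ⟨MulAction.orbit (G × G) x, fun g y hy => MulAction.mem_orbit_of_mem_orbit g hy⟩
    let C : SubMulAction (G × G) X :=
      ⟨(MulAction.orbit (G × G) x)ᶜ, fun g y hy h => hy (by
        simpa using MulAction.mem_orbit_of_mem_orbit g⁻¹ h)⟩
    have hXO : Biset.Iso G G X (O ⊕ C) := by
      classical
      refine Biset.Iso.symm ⟨Equiv.Set.sumCompl (MulAction.orbit (G × G) x), ?_⟩
      rintro g (y | y) <;> rfl
    rw [cls_eq_of_iso hXO, cls_sum]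
    refine add_mem (AddSubgroup.subset_closure ⟨_, hX x, cls_eq_of_iso ?_⟩) (ih _ ?_ C rfl ?_)
    · refine Biset.Iso.symm ⟨(MulAction.orbitEquivQuotientStabilizer (G × G) x).symm, ?_⟩
      intro g y
      obtain ⟨a, rfl⟩ := QuotientGroup.mk_surjective y
      refine Subtype.ext ?_
      rw [MulAction.Quotient.smul_coe, MulAction.orbitEquivQuotientStabilizer_symm_apply,
        smul_eq_mul, mul_smul]
      exact congrArg (g • ·) (MulAction.orbitEquivQuotientStabilizer_symm_apply (G × G) x a).symm
    · rw [← hn]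
      refine Finite.card_subtype_lt (x := x) ?_
      exact fun h => h (MulAction.mem_orbit_self x)
    · intro y
      have : MulAction.stabilizer (G × G) y = MulAction.stabilizer (G × G) (y : X) := by
        ext g; simp [MulAction.mem_stabilizer_iff, Subtype.ext_iff]
      rw [this]
      exact hX y

/-- The stabilizer of `x ×_G y` is the composition of the stabilizers of `x` and `y`. -/
theorem stabilizer_tmk {X Y : Type u} [MulAction (G × G) X] [MulAction (G × G) Y] (x : X) (y : Y) :
    MulAction.stabilizer (G × G) (Biset.tmk G G G x y) =
      starProduct (MulAction.stabilizer (G × G) x) (MulAction.stabilizer (G × G) y) := by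
  ext ⟨g, k⟩
  rw [MulAction.mem_stabilizer_iff, Biset.smul_tmk, Biset.tmk_eq_iff]
  change _ ↔ ∃ h : G, (g, h) • x = x ∧ (h, k) • y = y
  simp only [smul_smul, Prod.mk_mul_mk, one_mul, mul_one, eq_comm]

theorem stabilizer_coset_mem (S : DiagonalSystem G) {L : Subgroup (G × G)} (hL : L ∈ S.carrier)
    (x : (G × G) ⧸ L) : MulAction.stabilizer (G × G) x ∈ S.carrier := by
  obtain ⟨a, rfl⟩ := QuotientGroup.mk_surjective x
  have : ((a : G × G) : (G × G) ⧸ L) = a • (((1 : G × G) : (G × G) ⧸ L)) := by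
    rw [MulAction.Quotient.smul_coe]; simp
  rw [this, MulAction.stabilizer_smul_eq_stabilizer_map_conj, MulAction.stabilizer_quotient]
  exact S.conj_mem L hL a

theorem span_one_mem (S : DiagonalSystem G) : (1 : DoubleBurnside G) ∈ span S := by
  have : (1 : DoubleBurnside G) = cls (Biset.Regular G) := rfl
  rw [this]
  refine cls_mem_span S _ _ rfl ?_
  rintro ⟨a⟩
  have : MulAction.stabilizer (G × G) (Biset.Regular.mk a) =
      (diagonalSubgroup G).map (MulAut.conj ((a, 1) : G × G)).toMonoidHom := by
    ext ⟨g, h⟩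
    rw [MulAction.mem_stabilizer_iff, Biset.regular_smul]
    simp only [Biset.Regular.mk.injEq, Subgroup.mem_map, diagonalSubgroup, MonoidHom.mem_range,
      MonoidHom.prod_apply, MonoidHom.id_apply, exists_exists_eq_and]
    constructor
    · intro e
      refine ⟨h, Prod.ext ?_ ?_⟩
      · change a * h * a⁻¹ = g
        rw [eq_comm, eq_mul_inv_iff_mul_eq, ← mul_inv_eq_iff_eq_mul, e]
      · change 1 * h * 1⁻¹ = h
        simp
    · rintro ⟨k, hk⟩
      rw [Prod.ext_iff] at hk
      obtain ⟨h1, h2⟩ := hk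
      change a * k * a⁻¹ = g at h1
      change 1 * k * 1⁻¹ = h at h2
      rw [← h1, ← h2]
      simp
  rw [this]
  exact S.conj_mem _ S.diagonal_mem _

theorem span_mul_mem (S : DiagonalSystem G) {a b : DoubleBurnside G} (ha : a ∈ span S)
    (hb : b ∈ span S) : a * b ∈ span S := by
  induction ha, hb using AddSubgroup.closure_induction₂ with
  | mem x y hx hy =>
    obtain ⟨L, hL, rfl⟩ := hx
    obtain ⟨M, hM, rfl⟩ := hy
    rw [← cls_tensor]
    refine cls_mem_span S _ _ rfl fun t => ?_
    induction t using Biset.tensor_ind with | h x y =>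
    rw [stabilizer_tmk]
    exact S.star_mem _ (stabilizer_coset_mem S hL x) _ (stabilizer_coset_mem S hM y)
  | zero_left x hx => rw [zero_mul]; exact zero_mem _
  | zero_right x hx => rw [mul_zero]; exact zero_mem _
  | add_left x y z hx hy hz h1 h2 => rw [add_mul]; exact add_mem h1 h2
  | add_right x y z hx hy hz h1 h2 => rw [mul_add]; exact add_mem h1 h2
  | neg_left x y hx hy h => rw [neg_mul]; exact neg_mem h
  | neg_right x y hx hy h => rw [mul_neg]; exact neg_mem h

end DoubleBurnside

/-- The unital subring `B^S(G,G)` of `B(G,G)` spanned by the `[G × G / L]` with `L ∈ S`. -/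
def bisetSubring {G : Type u} [Group G] [Finite G] (S : DiagonalSystem G) :
    Subring (DoubleBurnside G) where
  carrier := DoubleBurnside.span S
  mul_mem' := DoubleBurnside.span_mul_mem S
  one_mem' := DoubleBurnside.span_one_mem S
  add_mem' := add_mem
  zero_mem' := zero_mem _
  neg_mem' := neg_mem

/-! ## Marks -/

namespace DoubleBurnside

variable {G : Type u} [Group G] [Finite G]

/-- The set of `L`-fixed points of a `G × G`-set. -/
def Fix (L : Subgroup (G × G)) (X : Type u) [MulAction (G × G) X] : Type u :=
  {x : X // ∀ l ∈ L, l • x = x}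

instance (L : Subgroup (G × G)) (X : Type u) [MulAction (G × G) X] [Finite X] :
    Finite (Fix L X) :=
  inferInstanceAs (Finite {x : X // ∀ l ∈ L, l • x = x})

theorem card_fix_congr (L : Subgroup (G × G)) {X Y : Type u} [MulAction (G × G) X]
    [MulAction (G × G) Y] (h : Biset.Iso G G X Y) : Nat.card (Fix L X) = Nat.card (Fix L Y) := by
  obtain ⟨e, he⟩ := h
  refine Nat.card_congr (e.subtypeEquiv fun x => ?_)
  refine forall₂_congr fun l _ => ?_
  rw [← he, e.apply_eq_iff_eq]

theorem card_fix_sum (L : Subgroup (G × G)) (X Y : Type u) [MulAction (G × G) X]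
    [MulAction (G × G) Y] [Finite X] [Finite Y] :
    Nat.card (Fix L (X ⊕ Y)) = Nat.card (Fix L X) + Nat.card (Fix L Y) := by
  rw [← Nat.card_sum]
  refine Nat.card_congr ⟨?_, ?_, ?_, ?_⟩
  · rintro ⟨x | y, h⟩
    · exact Sum.inl ⟨x, fun l hl => Sum.inl_injective (h l hl)⟩
    · exact Sum.inr ⟨y, fun l hl => Sum.inr_injective (h l hl)⟩
  · rintro (⟨x, h⟩ | ⟨y, h⟩)
    · exact ⟨Sum.inl x, fun l hl => congrArg Sum.inl (h l hl)⟩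
    · exact ⟨Sum.inr y, fun l hl => congrArg Sum.inr (h l hl)⟩
  · rintro ⟨x | y, h⟩ <;> rfl
  · rintro (⟨x, h⟩ | ⟨y, h⟩) <;> rfl

/-- The number of `L`-fixed points, on isomorphism classes. -/
def fixCount (L : Subgroup (G × G)) : BisetClass G →+ ℤ where
  toFun := Quotient.lift (fun X => (Nat.card (Fix L X.carrier) : ℤ))
    (fun _ _ h => congrArg _ (card_fix_congr L h))
  map_zero' := by
    change (Nat.card (Fix L PEmpty.{u + 1}) : ℤ) = 0
    have : IsEmpty (Fix L PEmpty.{u + 1}) := ⟨fun x => x.1.elim⟩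
    simp
  map_add' a b := by
    induction a using BisetClass.ind with | h X =>
    induction b using BisetClass.ind with | h Y =>
    change (Nat.card (Fix L (X ⊕ Y)) : ℤ) = (Nat.card (Fix L X) : ℤ) + (Nat.card (Fix L Y) : ℤ)
    rw [card_fix_sum]
    push_cast
    rfl

/-- The mark homomorphism `Φ_L : B(G,G) → ℤ`, `[X] ↦ |X^L|`. -/
def mark (L : Subgroup (G × G)) : DoubleBurnside G →+ ℤ := lift (fixCount L)

theorem mark_cls (L : Subgroup (G × G)) (X : Type u) [MulAction (G × G) X] [Finite X] :
    mark L (cls X) = Nat.card (Fix L X) := by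
  rw [mark, cls, lift_of]; rfl

theorem card_fix_conj (L : Subgroup (G × G)) (g : G × G) (X : Type u) [MulAction (G × G) X] :
    Nat.card (Fix (L.map (MulAut.conj g).toMonoidHom) X) = Nat.card (Fix L X) := by
  symm
  refine Nat.card_congr ((MulAction.toPerm g).subtypeEquiv fun x => ?_)
  simp only [Subgroup.mem_map, forall_exists_index, and_imp, forall_apply_eq_imp_iff₂]
  refine forall₂_congr fun l _ => ?_
  simp [MulAut.conj_apply, mul_smul]

theorem mark_conj (L : Subgroup (G × G)) (g : G × G) :
    mark (L.map (MulAut.conj g).toMonoidHom) = mark L := by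
  refine hom_ext fun c => ?_
  induction c using BisetClass.ind with | h X =>
  have := mark_cls (L.map (MulAut.conj g).toMonoidHom) X
  rw [card_fix_conj, ← mark_cls L X] at this
  exact this

/-- If `G` acts freely on the left, the centralizer of `φ(U)` acts freely on the fixed points. -/
theorem card_centralizer_dvd (S : DiagonalSystem G) {U : Type u} [Group U] (φ ψ : U →* G)
    {a : DoubleBurnside G} (ha : a ∈ bisetSubring S) :
    (Nat.card (Subgroup.centralizer (φ.range : Set G)) : ℤ) ∣ mark (pairSubgroup φ ψ) a := by
  change a ∈ AddSubgroup.closure _ at ha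
  induction ha using AddSubgroup.closure_induction with
  | zero => simp
  | add x y hx hy h1 h2 => rw [map_add]; exact dvd_add h1 h2
  | neg x hx h => rw [map_neg]; exact (dvd_neg).2 h
  | mem x hx =>
    obtain ⟨L, hL, rfl⟩ := hx
    rw [mark_cls, Int.natCast_dvd_natCast]
    let C := Subgroup.centralizer (φ.range : Set G)
    let _ : MulAction C (Fix (pairSubgroup φ ψ) ((G × G) ⧸ L)) :=
      { smul := fun c x => ⟨((c : G), (1 : G)) • x.1, by
          rintro _ ⟨u, rfl⟩
          have h1 := x.2 _ ⟨u, rfl⟩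
          have h2 := Subgroup.mem_centralizer_iff.1 c.2 (φ u) ⟨u, rfl⟩
          conv_rhs => rw [← h1]
          rw [smul_smul, smul_smul]
          congr 1
          ext
          · exact h2
          · simp⟩
        one_smul := fun x => Subtype.ext (one_smul (G × G) x.1)
        mul_smul := fun c d x => Subtype.ext (by
          change (((c * d : C) : G), (1 : G)) • x.1 =
            ((c : G), (1 : G)) • ((d : G), (1 : G)) • x.1
          rw [smul_smul]
          simp) }
    have hfree : ∀ x : Fix (pairSubgroup φ ψ) ((G × G) ⧸ L), MulAction.stabilizer C x = ⊥ := by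
      intro x
      rw [eq_bot_iff]
      intro c hc
      have h1 : ((c : G), (1 : G)) • x.1 = x.1 := congrArg Subtype.val hc
      have h2 := S.eq_one_of_mem (stabilizer_coset_mem S hL x.1) h1
      exact Subtype.ext h2
    rw [Nat.card_congr (MulAction.selfEquivOrbitsQuotientProd hfree), Nat.card_prod]
    exact dvd_mul_left _ _

end DoubleBurnside

/-! ## The category `S_G` -/

/-- The objects of the category `S_G`: the subgroups of `G`. -/
structure SubgroupObj {G : Type u} [Group G] (S : DiagonalSystem G) where
  toSubgroup : Subgroup G

namespace SubgroupObj

variable {G : Type u} [Group G] {S : DiagonalSystem G}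

/-- Morphisms `V ⟶ U` in `S_G`: the homomorphisms `φ : V → U` such that
`{(φ v, v) | v ∈ V}` belongs to `S`. -/
@[ext]
structure Hom (V U : SubgroupObj S) where
  toHom : V.toSubgroup →* U.toSubgroup
  mem : pairSubgroup (U.toSubgroup.subtype.comp toHom) V.toSubgroup.subtype ∈ S.carrier

theorem pair_comp {W V U : SubgroupObj S} (f : W.toSubgroup →* V.toSubgroup)
    (g : V.toSubgroup →* U.toSubgroup) :
    starProduct (pairSubgroup (U.toSubgroup.subtype.comp g) V.toSubgroup.subtype)
      (pairSubgroup (V.toSubgroup.subtype.comp f) W.toSubgroup.subtype) =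
    pairSubgroup (U.toSubgroup.subtype.comp (g.comp f)) W.toSubgroup.subtype := by
  ext ⟨a, b⟩
  constructor
  · rintro ⟨h, ⟨v, hv⟩, ⟨w, hw⟩⟩
    rw [Prod.ext_iff] at hv hw
    obtain ⟨hv1, hv2⟩ := hv
    obtain ⟨hw1, hw2⟩ := hw
    have : v = f w := Subtype.ext (hv2.trans hw1.symm)
    subst this
    exact ⟨w, Prod.ext hv1 hw2⟩
  · rintro ⟨w, hw⟩
    rw [Prod.ext_iff] at hw
    exact ⟨f w, ⟨f w, Prod.ext hw.1 rfl⟩, ⟨w, Prod.ext rfl hw.2⟩⟩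

theorem pair_id_mem (S : DiagonalSystem G) (U : Subgroup G) :
    pairSubgroup U.subtype U.subtype ∈ S.carrier := by
  refine S.subgroup_mem _ S.diagonal_mem _ ?_
  rintro _ ⟨u, rfl⟩
  exact ⟨u, rfl⟩

/-- The category `S_G`, with the usual composition of homomorphisms. -/
instance : Category (SubgroupObj S) where
  Hom := Hom
  id U := ⟨MonoidHom.id _, pair_id_mem S U.toSubgroup⟩
  comp f g := ⟨g.toHom.comp f.toHom, by
    rw [← pair_comp]
    exact S.star_mem _ g.mem _ f.mem⟩

@[ext]
theorem hom_ext {V U : SubgroupObj S} {f g : V ⟶ U} (h : ∀ v, Hom.toHom f v = Hom.toHom g v) :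
    f = g := Hom.ext (MonoidHom.ext h)

@[simp] theorem comp_apply {W V U : SubgroupObj S} (f : W ⟶ V) (g : V ⟶ U) (w : W.toSubgroup) :
    Hom.toHom (f ≫ g) w = Hom.toHom g (Hom.toHom f w) := rfl

@[simp] theorem id_apply {U : SubgroupObj S} (u : U.toSubgroup) :
    Hom.toHom (𝟙 U) u = u := rfl

/-- The object `G` of `S_G`. -/
def whole (S : DiagonalSystem G) : SubgroupObj S := ⟨⊤⟩

/-- A morphism to `G` in `S_G`, as a homomorphism to `G`. -/
def Hom.toGroup {U : SubgroupObj S} (φ : U ⟶ whole S) : U.toSubgroup →* G :=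
  (whole S).toSubgroup.subtype.comp (Hom.toHom φ)

theorem Hom.injective {V U : SubgroupObj S} (φ : V ⟶ U) : Function.Injective (Hom.toHom φ) := by
  obtain ⟨A, B, α, h⟩ := S.twisted _ φ.mem
  rw [injective_iff_map_eq_one]
  intro v hv
  have hm : ((1 : G), (v : G)) ∈ twistedDiagonal α := by
    rw [← h]
    exact ⟨v, Prod.ext (congrArg Subtype.val hv) rfl⟩
  obtain ⟨b, hb⟩ := hm
  rw [Prod.ext_iff] at hb
  obtain ⟨h1, h2⟩ := hb
  change ((α b : A) : G) = 1 at h1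
  change (b : G) = v at h2
  have hb1 : b = 1 := by
    rw [← map_eq_one_iff α α.injective]
    exact Subtype.ext h1
  exact Subtype.ext (by rw [← h2, hb1]; rfl)

/-- Every endomorphism in `S_G` is an automorphism, so `Aut U` is the set of all
endomorphisms of `U`. -/
theorem isIso_endo [Finite G] {U : SubgroupObj S} (f : U ⟶ U) : IsIso f := by
  have hinj : ∀ g : U ⟶ U, Function.Injective (fun h : U ⟶ U => h ≫ g) := fun g h h' e =>
    hom_ext fun v => Hom.injective g (by
      rw [← comp_apply, ← comp_apply]
      exact congrArg (fun k : U ⟶ U => Hom.toHom k v) e)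
  have hfin : Finite (U ⟶ U) :=
    Finite.of_injective (fun φ => (Hom.toHom φ : U.toSubgroup → U.toSubgroup))
      (fun _ _ h => hom_ext fun v => congrFun h v)
  obtain ⟨g, hg⟩ := (Finite.surjective_of_injective (hinj f)) (𝟙 U)
  have hg : g ≫ f = 𝟙 U := hg
  refine ⟨g, hinj f ?_, hg⟩
  change (f ≫ g) ≫ f = 𝟙 U ≫ f
  rw [Category.assoc, hg, Category.comp_id, Category.id_comp]

/-- The inner automorphism `c_u` of `U`. -/
def innerHom (U : SubgroupObj S) (u : U.toSubgroup) : U ⟶ U :=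
  ⟨(MulAut.conj u).toMonoidHom, by
    refine S.subgroup_mem _ (S.conj_mem _ S.diagonal_mem ((u : G), 1)) _ ?_
    rintro _ ⟨v, rfl⟩
    exact ⟨((v : G), (v : G)), ⟨v, rfl⟩, by ext <;> simp [MulAut.conj_apply]⟩⟩

@[simp] theorem innerHom_apply (U : SubgroupObj S) (u v : U.toSubgroup) :
    Hom.toHom (innerHom U u) v = u * v * u⁻¹ := rfl

/-- The homomorphism `U → Aut_{S_G}(U)`, `u ↦ c_u`. -/
def inner (U : SubgroupObj S) : U.toSubgroup →* Aut U where
  toFun u := ⟨innerHom U u, innerHom U u⁻¹, by ext v; simp [mul_assoc],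
    by ext v; simp [mul_assoc]⟩
  map_one' := by
    apply CategoryTheory.Iso.ext
    change innerHom U 1 = 𝟙 U
    ext v
    simp
  map_mul' u w := by
    apply CategoryTheory.Iso.ext
    change innerHom U (u * w) = innerHom U w ≫ innerHom U u
    ext v
    simp [mul_assoc]

instance (U : SubgroupObj S) : (inner U).range.Normal where
  conj_mem := by
    rintro _ ⟨u, rfl⟩ α
    refine ⟨Hom.toHom α.hom u, ?_⟩
    apply CategoryTheory.Iso.ext
    change innerHom U _ = α.inv ≫ innerHom U u ≫ α.hom
    ext v
    have : Hom.toHom α.hom (Hom.toHom α.inv v) = v := by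
      rw [← comp_apply, α.inv_hom_id, id_apply]
    simp [this]

/-- The group `Out_{S_G}(U) = Aut_{S_G}(U) / Inn(U)`. -/
abbrev OutGroup (U : SubgroupObj S) : Type u := Aut U ⧸ (inner U).range

/-- Two morphisms `U ⟶ V` are equivalent if they differ by an inner automorphism of `V`. -/
def homSetoid (U V : SubgroupObj S) : Setoid (U ⟶ V) where
  r φ φ' := ∃ v : V.toSubgroup, ∀ u, Hom.toHom φ' u = v * Hom.toHom φ u * v⁻¹
  iseqv := by
    refine ⟨fun _ => ⟨1, by simp⟩, ?_, ?_⟩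
    · rintro φ φ' ⟨v, hv⟩
      exact ⟨v⁻¹, fun u => by simp [hv, mul_assoc]⟩
    · rintro φ φ' φ'' ⟨v, hv⟩ ⟨w, hw⟩
      exact ⟨w * v, fun u => by simp [hv, hw, mul_assoc]⟩

/-- The set `Inn(V) \ Hom_{S_G}(U, V)`. -/
def HomBar (U V : SubgroupObj S) : Type u := Quotient (homSetoid U V)

/-- The class `[φ]`. -/
def HomBar.mk {U V : SubgroupObj S} (φ : U ⟶ V) : HomBar U V := Quotient.mk (homSetoid U V) φ

instance [Finite G] (U V : SubgroupObj S) : Finite (U ⟶ V) :=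
  Finite.of_injective (fun φ => (Hom.toHom φ : U.toSubgroup → V.toSubgroup))
    (fun _ _ h => hom_ext fun v => congrFun h v)

instance [Finite G] (U V : SubgroupObj S) : Finite (HomBar U V) :=
  inferInstanceAs (Finite (Quotient (homSetoid U V)))

/-- Precomposition with an automorphism of `U`. -/
def HomBar.precomp {U V : SubgroupObj S} (α : Aut U) : HomBar U V → HomBar U V :=
  Quotient.map (α.hom ≫ ·) (by
    rintro φ φ' ⟨v, hv⟩
    exact ⟨v, fun u => by simp [hv]⟩)

/-- The right action of `Out_{S_G}(U)`: `[φ] [α] = [φ ∘ α]`. -/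
instance outAction (U V : SubgroupObj S) : MulAction (OutGroup U)ᵐᵒᵖ (HomBar U V) where
  smul x := Quotient.lift (s := QuotientGroup.leftRel (inner U).range) HomBar.precomp (by
    intro α β hαβ
    obtain ⟨w, hw⟩ := QuotientGroup.leftRel_apply.1 hαβ
    have hβ : β = α * inner U w := by rw [hw]; group
    subst hβ
    funext c
    induction c using Quotient.ind with | _ φ =>
    refine Quotient.sound ⟨Hom.toHom φ (Hom.toHom α.hom w), fun u => ?_⟩
    change Hom.toHom ((innerHom U w ≫ α.hom) ≫ φ) u = _
    simp) x.unop
  one_smul c := by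
    induction c using Quotient.ind with | _ φ =>
    exact Quotient.sound ⟨1, fun u => by simp; rfl⟩
  mul_smul x y c := by
    induction c using Quotient.ind with | _ φ =>
    obtain ⟨α, hα⟩ := QuotientGroup.mk_surjective x.unop
    obtain ⟨β, hβ⟩ := QuotientGroup.mk_surjective y.unop
    obtain rfl : x = MulOpposite.op (α : OutGroup U) := by rw [hα]; rfl
    obtain rfl : y = MulOpposite.op (β : OutGroup U) := by rw [hβ]; rfl
    rfl

theorem smul_mk {U V : SubgroupObj S} (α : Aut U) (φ : U ⟶ V) :
    MulOpposite.op (α : OutGroup U) • HomBar.mk φ = HomBar.mk (α.hom ≫ φ) := rfl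

/-- The endomorphism algebra of the permutation module `R \overline{Hom}_{S_G}(U, G)` over
`R Out_{S_G}(U)`: all `R`-linear endomorphisms that commute with the action of the group. -/
def EndOut (R : Type v) [CommRing R] (U : SubgroupObj S) :
    Subalgebra R (Module.End R (HomBar U (whole S) →₀ R)) :=
  Subalgebra.centralizer R
    (Set.range fun x : (OutGroup U)ᵐᵒᵖ => Finsupp.lmapDomain R R (x • · : HomBar U (whole S) → _))

instance (R : Type v) [CommRing R] (U : SubgroupObj S) : Ring (EndOut R U) :=
  Algebra.semiringToRing R

end SubgroupObj

/-! ## The homomorphism `σ̃` -/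

section SigmaTilde

open SubgroupObj DoubleBurnside

variable {G : Type u} [Group G] [Finite G] {S : DiagonalSystem G}

/-- The integer `Φ_{Δ(φ(U), φ ψ⁻¹, ψ(U))}(a) / |C_G(φ(U))|`. -/
def coeff {U : SubgroupObj S} (a : bisetSubring S) (φ ψ : U ⟶ whole S) : ℤ :=
  mark (pairSubgroup φ.toGroup ψ.toGroup) a /
    (Nat.card (Subgroup.centralizer (φ.toGroup.range : Set G)) : ℤ)

/-- The division in `coeff` is exact. -/
theorem coeff_mul_card {U : SubgroupObj S} (a : bisetSubring S) (φ ψ : U ⟶ whole S) :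
    coeff a φ ψ * (Nat.card (Subgroup.centralizer (φ.toGroup.range : Set G)) : ℤ) =
      mark (pairSubgroup φ.toGroup ψ.toGroup) a :=
  Int.ediv_mul_cancel (card_centralizer_dvd S _ _ a.2)

theorem coeff_add {U : SubgroupObj S} (a b : bisetSubring S) (φ ψ : U ⟶ whole S) :
    coeff (a + b) φ ψ = coeff a φ ψ + coeff b φ ψ := by
  have h : (Nat.card (Subgroup.centralizer (φ.toGroup.range : Set G)) : ℤ) ≠ 0 := by
    exact_mod_cast Nat.card_pos.ne'
  apply mul_right_cancel₀ h
  rw [add_mul, coeff_mul_card, coeff_mul_card, coeff_mul_card, Subring.coe_add, map_add]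

/-- The coefficient depends only on the classes of `φ` and `ψ`. -/
theorem coeff_congr {U : SubgroupObj S} (a : bisetSubring S) {φ φ' ψ ψ' : U ⟶ whole S}
    (hφ : homSetoid U (whole S) φ φ') (hψ : homSetoid U (whole S) ψ ψ') :
    coeff a φ ψ = coeff a φ' ψ' := by
  obtain ⟨v, hv⟩ := hφ
  obtain ⟨w, hw⟩ := hψ
  have h1 : pairSubgroup φ'.toGroup ψ'.toGroup =
      (pairSubgroup φ.toGroup ψ.toGroup).map
        (MulAut.conj ((v : G), (w : G))).toMonoidHom := by
    have e : φ'.toGroup.prod ψ'.toGroup = (MulAut.conj ((v : G), (w : G))).toMonoidHom.comp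
        (φ.toGroup.prod ψ.toGroup) :=
      MonoidHom.ext fun u => Prod.ext (congrArg Subtype.val (hv u)) (congrArg Subtype.val (hw u))
    rw [pairSubgroup, pairSubgroup, e, MonoidHom.range_comp]
  have h2 : φ'.toGroup.range = φ.toGroup.range.map (MulAut.conj (v : G)).toMonoidHom := by
    have e : φ'.toGroup = (MulAut.conj (v : G)).toMonoidHom.comp φ.toGroup :=
      MonoidHom.ext fun u => congrArg Subtype.val (hv u)
    rw [e, MonoidHom.range_comp]
  have h3 : Nat.card (Subgroup.centralizer (φ'.toGroup.range : Set G)) =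
      Nat.card (Subgroup.centralizer (φ.toGroup.range : Set G)) := by
    symm
    refine Nat.card_congr ((MulAut.conj (v : G)).toEquiv.subtypeEquiv fun x => ?_)
    rw [h2, Subgroup.mem_centralizer_iff, Subgroup.mem_centralizer_iff]
    simp only [SetLike.mem_coe, Subgroup.mem_map, forall_exists_index, and_imp,
      forall_apply_eq_imp_iff₂]
    refine forall₂_congr fun y _ => ?_
    change y * x = x * y ↔ MulAut.conj (v : G) y * MulAut.conj (v : G) x =
      MulAut.conj (v : G) x * MulAut.conj (v : G) y
    rw [← map_mul, ← map_mul, (MulAut.conj (v : G)).injective.eq_iff]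
  rw [coeff, coeff, h1, mark_conj, h3]

theorem coeff_precomp {U : SubgroupObj S} (a : bisetSubring S) (φ ψ : U ⟶ whole S) (α : Aut U) :
    coeff a (α.hom ≫ φ) (α.hom ≫ ψ) = coeff a φ ψ := by
  have hs : Function.Surjective (Hom.toHom α.hom) := fun v =>
    ⟨Hom.toHom α.inv v, by
      rw [← SubgroupObj.comp_apply, α.inv_hom_id, SubgroupObj.id_apply]⟩
  have h1 : pairSubgroup (Hom.toGroup (α.hom ≫ φ)) (Hom.toGroup (α.hom ≫ ψ)) =
      pairSubgroup φ.toGroup ψ.toGroup := by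
    ext x
    exact (hs.exists (p := fun u => (φ.toGroup u, ψ.toGroup u) = x)).symm
  have h2 : (Hom.toGroup (α.hom ≫ φ)).range = φ.toGroup.range := by
    ext x
    exact (hs.exists (p := fun u => φ.toGroup u = x)).symm
  rw [coeff, coeff, h1, h2]

/-- The coefficient, as a function of `[φ]` and `[ψ]`. -/
def coeffBar {U : SubgroupObj S} (a : bisetSubring S) (p q : HomBar U (whole S)) : ℤ :=
  Quotient.lift₂ (coeff a) (fun _ _ _ _ h h' => coeff_congr a h h') p q

@[simp] theorem coeffBar_mk {U : SubgroupObj S} (a : bisetSubring S) (φ ψ : U ⟶ whole S) :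
    coeffBar a (HomBar.mk φ) (HomBar.mk ψ) = coeff a φ ψ := rfl

/-- The `R`-linear map `[ψ] ↦ ∑_{[φ]} (Φ_{Δ(φ(U), φ ψ⁻¹, ψ(U))}(a) / |C_G(φ(U))|) [φ]`. -/
def sigmaLinear (R : Type v) [CommRing R] (U : SubgroupObj S) (a : bisetSubring S) :
    Module.End R (HomBar U (whole S) →₀ R) :=
  Finsupp.linearCombination R fun q : HomBar U (whole S) =>
    Finsupp.equivFunOnFinite.symm fun p : HomBar U (whole S) => (coeffBar a p q : R)

theorem sigmaLinear_single (R : Type v) [CommRing R] (U : SubgroupObj S) (a : bisetSubring S)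
    (p q : HomBar U (whole S)) :
    sigmaLinear R U a (Finsupp.single q 1) p = (coeffBar a p q : R) := by
  simp [sigmaLinear]

theorem coeffBar_add {U : SubgroupObj S} (a b : bisetSubring S) (p q : HomBar U (whole S)) :
    coeffBar (a + b) p q = coeffBar a p q + coeffBar b p q := by
  induction p using Quotient.ind with | _ φ =>
  induction q using Quotient.ind with | _ ψ =>
  exact coeff_add a b φ ψ

theorem coeffBar_smul {U : SubgroupObj S} (a : bisetSubring S) (x : (OutGroup U)ᵐᵒᵖ)
    (p q : HomBar U (whole S)) : coeffBar a (x • p) (x • q) = coeffBar a p q := by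
  induction p using Quotient.ind with | _ φ =>
  induction q using Quotient.ind with | _ ψ =>
  obtain ⟨α, hα⟩ := QuotientGroup.mk_surjective x.unop
  obtain rfl : x = MulOpposite.op (α : OutGroup U) := by rw [hα]; rfl
  exact coeff_precomp a φ ψ α

theorem sigmaLinear_mem (R : Type v) [CommRing R] (U : SubgroupObj S) (a : bisetSubring S) :
    sigmaLinear R U a ∈ EndOut R U := by
  rw [EndOut, Subalgebra.mem_centralizer_iff]
  rintro _ ⟨x, rfl⟩
  refine Finsupp.lhom_ext' fun q => LinearMap.ext_ring ?_
  ext p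
  have hx : Function.Injective (x • · : HomBar U (whole S) → _) := MulAction.injective x
  obtain ⟨p, rfl⟩ := MulAction.surjective x p
  change Finsupp.mapDomain (x • ·) (sigmaLinear R U a (Finsupp.single q 1)) (x • p) =
    sigmaLinear R U a (Finsupp.mapDomain (x • ·) (Finsupp.single q 1)) (x • p)
  rw [Finsupp.mapDomain_apply hx, Finsupp.mapDomain_single, sigmaLinear_single,
    sigmaLinear_single, coeffBar_smul]

/-- The group homomorphism `σ̃_{G,U}`, with coefficients in `R`. -/
def sigmaTildeAt (R : Type v) [CommRing R] (U : SubgroupObj S) : bisetSubring S →+ EndOut R U :=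
  AddMonoidHom.mk' (G := EndOut R U)
    (fun a : bisetSubring S => ⟨sigmaLinear R U a, sigmaLinear_mem R U a⟩) (fun a b => by
    refine Subtype.ext (Finsupp.lhom_ext' fun q => LinearMap.ext_ring ?_)
    ext p
    change sigmaLinear R U (a + b) (Finsupp.single q 1) p =
      sigmaLinear R U a (Finsupp.single q 1) p + sigmaLinear R U b (Finsupp.single q 1) p
    rw [sigmaLinear_single, sigmaLinear_single, sigmaLinear_single, coeffBar_add, Int.cast_add])

/-- The group homomorphism `σ̃_G` from `B^S(G,G)` to the (finite) direct sum, over a set `T` of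
subgroups `U` of `G`, of the endomorphism rings over `R Out_{S_G}(U)`. -/
def sigmaTilde (R : Type v) [CommRing R] (T : Set (SubgroupObj S)) :
    bisetSubring S →+ ((U : T) → EndOut R (U : SubgroupObj S)) :=
  AddMonoidHom.mk' (fun a U => sigmaTildeAt R (U : SubgroupObj S) a)
    (fun a b => funext fun _ => map_add _ a b)

/-- The `R`-module homomorphism induced by `σ̃_G` on `R B^S(G,G) = R ⊗ B^S(G,G)`. -/
def sigmaTildeBaseChange (R : Type v) [CommRing R] (T : Set (SubgroupObj S)) :
    R ⊗[ℤ] bisetSubring S →ₗ[R] ((U : T) → EndOut R (U : SubgroupObj S)) :=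
  LinearMap.liftBaseChange R (sigmaTilde R T).toIntLinearMap

end SigmaTilde

end

/-! Ring homomorphism. The stabilizer of `x ×_G y` is the `*`-product of the stabilizers of `x` and
`y`. A member of `S` meets `G × 1` trivially, so a pair `(φ, ψ)` that fixes `x ×_G y` passes through
exactly one intermediate morphism `χ`, where `(φ, χ)` fixes `x` and `(χ, ψ)` fixes `y`. Counting
pairs `(x, y)` in two ways gives `|G| Φ_{φ,ψ}(ab) = ∑_χ Φ_{φ,χ}(a) Φ_{χ,ψ}(b)`
(`card_mul_mark_mul`). Each class `[χ]` has `|G| / |C_G(χ(U))|` members, so after division by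
centralizer orders this is the product rule for matrices indexed by `HomBar U (whole S)`
(`coeffBar_mul`).

Injectivity. The classes `[G × G / L]`, with `L` in `S` up to conjugacy, span `B^S(G,G)`. Write each
representative `L` as `{(φ u, ψ u)}` with `U` in `T`, and read off the entry of `σ̃` at `([φ],
[ψ])`. The resulting square matrix is the table of marks with each row divided by a centralizer
order. It is triangular with respect to `|L|`, and its diagonal entries divide `|G|²`, so its
determinant divides a power of `|G|` (`det_coeffMatrix_dvd`). A regular determinant makes `σ̃`
injective.

Image. If `S° = S`, every position `([χ], [ω])` corresponds to a member of `S`, and two positions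
with conjugate subgroups differ by an element of `Out`. An equivariant endomorphism is therefore
determined by the chosen entries (`entries_injective`). With the adjugate matrix, every family whose
entries are divisible by the determinant lies in the image. This yields finite index over `ℤ`, and
surjectivity once `|G|` is a unit. -/

noncomputable section

/-! ### Conjugation on morphisms to `G`: orbits and stabilizers -/

namespace SubgroupObj

variable {G : Type u} [Group G] {S : DiagonalSystem G}

/-- The group `V` acts on the morphisms `U ⟶ V` through its inner automorphisms. -/
instance conjAction (U V : SubgroupObj S) : MulAction V.toSubgroup (U ⟶ V) where
  smul v φ := φ ≫ innerHom V v
  one_smul φ := hom_ext fun u => by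
    change 1 * Hom.toHom φ u * 1⁻¹ = _
    simp
  mul_smul v w φ := hom_ext fun u => by
    change v * w * Hom.toHom φ u * (v * w)⁻¹ = v * (w * Hom.toHom φ u * w⁻¹) * v⁻¹
    simp [mul_assoc]

theorem conj_smul_apply {U V : SubgroupObj S} (v : V.toSubgroup) (φ : U ⟶ V) (u : U.toSubgroup) :
    Hom.toHom (v • φ) u = v * Hom.toHom φ u * v⁻¹ := rfl

theorem mem_orbit_iff_mk_eq {U V : SubgroupObj S} {φ φ' : U ⟶ V} :
    φ' ∈ MulAction.orbit V.toSubgroup φ ↔ HomBar.mk φ' = HomBar.mk φ := by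
  have h : HomBar.mk φ = HomBar.mk φ' ↔ homSetoid U V φ φ' := Quotient.eq (r := homSetoid U V)
  rw [eq_comm, h]
  exact exists_congr fun v => ⟨fun e u => by rw [← e]; rfl, fun e => hom_ext fun u => (e u).symm⟩

theorem mem_stabilizer_iff {U : SubgroupObj S} (φ : U ⟶ whole S) (g : (whole S).toSubgroup) :
    g ∈ MulAction.stabilizer (whole S).toSubgroup φ ↔
      (g : G) ∈ Subgroup.centralizer (φ.toGroup.range : Set G) := by
  rw [MulAction.mem_stabilizer_iff, Subgroup.mem_centralizer_iff]
  constructor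
  · rintro e _ ⟨u, rfl⟩
    have h : g * Hom.toHom φ u * g⁻¹ = Hom.toHom φ u := by rw [← conj_smul_apply, e]
    exact congrArg Subtype.val (mul_inv_eq_iff_eq_mul.1 h).symm
  · intro h
    refine hom_ext fun u => ?_
    rw [conj_smul_apply, mul_inv_eq_iff_eq_mul]
    exact Subtype.ext (h _ ⟨u, rfl⟩).symm

theorem card_stabilizer {U : SubgroupObj S} (φ : U ⟶ whole S) :
    Nat.card (MulAction.stabilizer (whole S).toSubgroup φ) =
      Nat.card (Subgroup.centralizer (φ.toGroup.range : Set G)) :=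
  Nat.card_congr (Subgroup.topEquiv.toEquiv.subtypeEquiv (mem_stabilizer_iff φ))

/-- A sum over classes of morphisms to `G`, as a weighted sum over morphisms. -/
theorem sum_mul_card_centralizer [Finite G] {U : SubgroupObj S} [Fintype (U ⟶ whole S)]
    [Fintype (HomBar U (whole S))] (F : HomBar U (whole S) → ℤ) :
    ∑ χ : U ⟶ whole S,
        F (HomBar.mk χ) * Nat.card (Subgroup.centralizer (χ.toGroup.range : Set G)) =
      Nat.card G * ∑ p, F p := by
  classical
  rw [← Fintype.sum_fiberwise (HomBar.mk (U := U) (V := whole S)), Finset.mul_sum]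
  refine Finset.sum_congr rfl fun p _ => ?_
  induction p using Quotient.ind with | _ φ =>
  change ∑ χ : {χ : U ⟶ whole S // HomBar.mk χ = HomBar.mk φ}, _ = _ * F (HomBar.mk φ)
  -- The summand is constant on a fibre, because morphisms in one orbit have isomorphic stabilizers,
  -- and these stabilizers are the centralizers of the images.
  have hconst : ∀ χ : {χ : U ⟶ whole S // HomBar.mk χ = HomBar.mk φ},
      F (HomBar.mk χ.1) * (Nat.card (Subgroup.centralizer (χ.1.toGroup.range : Set G)) : ℤ) =
      F (HomBar.mk φ) * Nat.card (Subgroup.centralizer (φ.toGroup.range : Set G)) := by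
    rintro ⟨χ, hχ⟩
    obtain ⟨g, rfl⟩ := mem_orbit_iff_mk_eq.2 hχ
    have h1 : Nat.card (MulAction.stabilizer (whole S).toSubgroup (g • φ)) =
        Nat.card (MulAction.stabilizer (whole S).toSubgroup φ) :=
      Nat.card_congr (MulAction.stabilizerEquivStabilizer (g := g) (a := φ) rfl).symm.toEquiv
    rw [card_stabilizer, card_stabilizer] at h1
    dsimp only at hχ ⊢
    rw [hχ, h1]
  rw [Finset.sum_congr rfl fun χ _ => hconst χ, Finset.sum_const, Finset.card_univ,
    ← Nat.card_eq_fintype_card, nsmul_eq_mul]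
  -- Orbit-stabilizer: the fibre over `[φ]` is the orbit of `φ`.
  have h2 : Nat.card {χ : U ⟶ whole S // HomBar.mk χ = HomBar.mk φ} *
      Nat.card (Subgroup.centralizer (φ.toGroup.range : Set G)) = Nat.card G := by
    have e : Nat.card {χ : U ⟶ whole S // HomBar.mk χ = HomBar.mk φ} =
        Nat.card (MulAction.orbit (whole S).toSubgroup φ) :=
      Nat.card_congr (Equiv.subtypeEquivRight fun χ => mem_orbit_iff_mk_eq.symm)
    rw [e, ← card_stabilizer, ← Nat.card_prod,
      Nat.card_congr (MulAction.orbitProdStabilizerEquivGroup (whole S).toSubgroup φ)]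
    exact Nat.card_congr Subgroup.topEquiv.toEquiv
  rw [← h2]
  push_cast
  ring

end SubgroupObj

/-! ### Marks of tensor products and of the identity -/

namespace DoubleBurnside

open SubgroupObj

variable {G : Type u} [Group G] {S : DiagonalSystem G}

/-- A morphism through which a fixed point of `X ×_G Y` factors. -/
theorem exists_intermediate {U : SubgroupObj S} (φ ψ : U ⟶ whole S) {L M : Subgroup (G × G)}
    (hM : M ∈ S.carrier) (h : pairSubgroup φ.toGroup ψ.toGroup ≤ starProduct L M) :
    ∃ χ : U ⟶ whole S, pairSubgroup φ.toGroup χ.toGroup ≤ L ∧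
      pairSubgroup χ.toGroup ψ.toGroup ≤ M := by
  -- In a member of `S` the right coordinate determines the left one. This is what makes the chosen
  -- function `f` multiplicative.
  have huniq : ∀ {g h k : G}, (g, k) ∈ M → (h, k) ∈ M → g = h := fun {g h k} h1 h2 => by
    have := M.mul_mem h1 (M.inv_mem h2)
    rw [Prod.inv_mk, Prod.mk_mul_mk, mul_inv_cancel] at this
    exact mul_inv_eq_one.1 (S.eq_one_of_mem hM this)
  choose f hf1 hf2 using fun u : U.toSubgroup =>
    (h ⟨u, rfl⟩ : ((φ.toGroup u, ψ.toGroup u) : G × G) ∈ starProduct L M)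
  dsimp only at hf1 hf2
  let F : U.toSubgroup →* G := MonoidHom.mk' f fun a b => huniq (hf2 (a * b)) (by
    simpa using M.mul_mem (hf2 a) (hf2 b))
  -- The graph of `χ` lies in the `*`-product of `M` with the graph of `ψ`, so `χ` is a morphism
  -- without any symmetry of `S`.
  let χ : U ⟶ whole S := ⟨F.codRestrict ⊤ fun _ => trivial, by
    refine S.subgroup_mem _ (S.star_mem _ hM _ ψ.mem) _ ?_
    rintro _ ⟨u, rfl⟩
    exact ⟨ψ.toGroup u, hf2 u, ⟨u, rfl⟩⟩⟩
  refine ⟨χ, ?_, ?_⟩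
  · rintro _ ⟨u, rfl⟩
    exact hf1 u
  · rintro _ ⟨u, rfl⟩
    exact hf2 u

theorem intermediate_unique {U : SubgroupObj S} {χ χ' ψ : U ⟶ whole S} {M : Subgroup (G × G)}
    (hM : M ∈ S.carrier) (h : pairSubgroup χ.toGroup ψ.toGroup ≤ M)
    (h' : pairSubgroup χ'.toGroup ψ.toGroup ≤ M) : χ = χ' := by
  refine SubgroupObj.hom_ext fun u => Subtype.ext ?_
  have := M.mul_mem (h ⟨u, rfl⟩) (M.inv_mem (h' ⟨u, rfl⟩))
  simp only [MonoidHom.prod_apply, Prod.inv_mk, Prod.mk_mul_mk, mul_inv_cancel] at this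
  exact mul_inv_eq_one.1 (S.eq_one_of_mem hM this)

/-- The fixed points of `X ×_G Y`, counted through the intermediate morphisms. -/
theorem card_fix_tensor [Finite G] {U : SubgroupObj S} [Fintype (U ⟶ whole S)]
    (φ ψ : U ⟶ whole S) (X Y : Type u) [MulAction (G × G) X] [MulAction (G × G) Y]
    [Finite X] [Finite Y] (hY : ∀ y : Y, MulAction.stabilizer (G × G) y ∈ S.carrier) :
    Nat.card G * Nat.card (Fix (pairSubgroup φ.toGroup ψ.toGroup) (Biset.Tensor G G G X Y)) =
      ∑ χ : U ⟶ whole S, Nat.card (Fix (pairSubgroup φ.toGroup χ.toGroup) X) *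
        Nat.card (Fix (pairSubgroup χ.toGroup ψ.toGroup) Y) := by
  -- The pairs `(x, y)` whose orbit is a fixed point are counted twice: by their unique intermediate
  -- morphism, and by the orbit that contains them.
  let A := {p : X × Y // pairSubgroup φ.toGroup ψ.toGroup ≤
    MulAction.stabilizer (G × G) (Biset.tmk G G G p.1 p.2)}
  have h1 : Nat.card A =
      ∑ χ : U ⟶ whole S, Nat.card (Fix (pairSubgroup φ.toGroup χ.toGroup) X) *
        Nat.card (Fix (pairSubgroup χ.toGroup ψ.toGroup) Y) := by
    simp only [← Nat.card_prod]
    rw [← Nat.card_sigma]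
    symm
    let f : (Σ χ : U ⟶ whole S, Fix (pairSubgroup φ.toGroup χ.toGroup) X ×
        Fix (pairSubgroup χ.toGroup ψ.toGroup) Y) → A := fun s => ⟨(s.2.1.1, s.2.2.1), by
      rw [stabilizer_tmk]
      rintro _ ⟨u, rfl⟩
      exact ⟨s.1.toGroup u, s.2.1.2 _ ⟨u, rfl⟩, s.2.2.2 _ ⟨u, rfl⟩⟩⟩
    refine Nat.card_congr (Equiv.ofBijective f ⟨?_, ?_⟩)
    · rintro ⟨χ, ⟨x, hx⟩, ⟨y, hy⟩⟩ ⟨χ', ⟨x', hx'⟩, ⟨y', hy'⟩⟩ h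
      obtain ⟨rfl, rfl⟩ := Prod.ext_iff.1 (congrArg Subtype.val h)
      obtain rfl : χ = χ' := intermediate_unique (hY y) hy hy'
      rfl
    · rintro ⟨⟨x, y⟩, h⟩
      rw [stabilizer_tmk] at h
      obtain ⟨χ, h1, h2⟩ := exists_intermediate φ ψ (hY y) h
      exact ⟨⟨χ, ⟨x, h1⟩, ⟨y, h2⟩⟩, rfl⟩
  rw [← h1, mul_comm, ← Nat.card_prod]
  have hs : ∀ t : Biset.Tensor G G G X Y, ∃ p : X × Y, Biset.tmk G G G p.1 p.2 = t := fun t => by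
    induction t using Biset.tensor_ind with | h x y => exact ⟨(x, y), rfl⟩
  choose r hr using hs
  have hmove : ∀ (h : G) (x : X) (y : Y),
      Biset.tmk G G G (((1, h) : G × G) • x) (((h, 1) : G × G) • y) = Biset.tmk G G G x y :=
    fun h x y => (Biset.tmk_eq_iff.2 ⟨h, rfl, rfl⟩).symm
  -- Translates of a chosen representative. The left action of `G` on `Y` is free, since its
  -- stabilizers lie in `S`, so every orbit contributes exactly `|G|` pairs.
  let f : Fix (pairSubgroup φ.toGroup ψ.toGroup) (Biset.Tensor G G G X Y) × G → A := fun s =>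
    ⟨(((1, s.2) : G × G) • (r s.1.1).1, ((s.2, 1) : G × G) • (r s.1.1).2), by
      dsimp only
      rw [hmove, hr]
      exact s.1.2⟩
  refine Nat.card_congr (Equiv.ofBijective f ⟨?_, ?_⟩)
  · rintro ⟨⟨t, ht⟩, g⟩ ⟨⟨t', ht'⟩, g'⟩ h
    obtain ⟨e1, e2⟩ := Prod.ext_iff.1 (congrArg Subtype.val h)
    dsimp only [f] at e1 e2
    obtain rfl : t = t' := by
      rw [← hr t, ← hr t', ← hmove g (r t).1, ← hmove g' (r t').1, e1, e2]
    have e3 : ((g'⁻¹ * g, 1) : G × G) ∈ MulAction.stabilizer (G × G) (r t).2 := by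
      have : ((g'⁻¹ * g, 1) : G × G) = ((g', 1) : G × G)⁻¹ * (g, 1) := by simp
      rw [MulAction.mem_stabilizer_iff, this, mul_smul, e2, inv_smul_smul]
    obtain rfl : g' = g := inv_mul_eq_one.1 (S.eq_one_of_mem (hY _) e3)
    rfl
  · rintro ⟨⟨x, y⟩, h⟩
    obtain ⟨g, e1, e2⟩ := Biset.tmk_eq_iff.1 (hr (Biset.tmk G G G x y))
    exact ⟨⟨⟨Biset.tmk G G G x y, h⟩, g⟩, Subtype.ext (Prod.ext e1.symm e2.symm)⟩

/-- Both sides are biadditive, so it suffices to treat the spanning classes, where this is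
`card_fix_tensor`. -/
theorem card_mul_mark_mul [Finite G] {U : SubgroupObj S} [Fintype (U ⟶ whole S)]
    (φ ψ : U ⟶ whole S) {a b : DoubleBurnside G} (ha : a ∈ bisetSubring S)
    (hb : b ∈ bisetSubring S) :
    (Nat.card G : ℤ) * mark (pairSubgroup φ.toGroup ψ.toGroup) (a * b) =
      ∑ χ : U ⟶ whole S, mark (pairSubgroup φ.toGroup χ.toGroup) a *
        mark (pairSubgroup χ.toGroup ψ.toGroup) b := by
  change a ∈ AddSubgroup.closure _ at ha
  change b ∈ AddSubgroup.closure _ at hb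
  induction ha, hb using AddSubgroup.closure_induction₂ with
  | mem x y hx hy =>
    obtain ⟨L, hL, rfl⟩ := hx
    obtain ⟨M, hM, rfl⟩ := hy
    rw [← cls_tensor, mark_cls]
    simp only [mark_cls]
    exact_mod_cast card_fix_tensor φ ψ _ _ (stabilizer_coset_mem S hM)
  | zero_left x hx => simp
  | zero_right x hx => simp
  | add_left x y z hx hy hz h1 h2 =>
    simp only [add_mul, map_add, mul_add, h1, h2, Finset.sum_add_distrib]
  | add_right x y z hx hy hz h1 h2 =>
    simp only [map_add, mul_add, h1, h2, Finset.sum_add_distrib]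
  | neg_left x y hx hy h => simp [h]
  | neg_right x y hx hy h => simp [h]

/-- The unit is the class of the biset `G`, and `g` is fixed by all `(φ u, ψ u)` exactly when `φ` is
`ψ` followed by conjugation by `g`. -/
theorem mark_one [Finite G] {U : SubgroupObj S} (φ ψ : U ⟶ whole S) :
    mark (pairSubgroup φ.toGroup ψ.toGroup) (1 : DoubleBurnside G) =
      Nat.card {g : (whole S).toSubgroup // g • ψ = φ} := by
  have : (1 : DoubleBurnside G) = cls (Biset.Regular G) := rfl
  rw [this, mark_cls]
  norm_cast
  let e : Biset.Regular G ≃ (whole S).toSubgroup :=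
    ⟨fun x => ⟨x.val, trivial⟩, fun g => ⟨g⟩, fun _ => rfl, fun _ => rfl⟩
  refine Nat.card_congr (e.subtypeEquiv ?_)
  rintro ⟨g⟩
  constructor
  · intro h
    refine SubgroupObj.hom_ext fun u => Subtype.ext ?_
    have h1 := congrArg Biset.Regular.val (h _ ⟨u, rfl⟩)
    change φ.toGroup u * g * (ψ.toGroup u)⁻¹ = g at h1
    change g * ψ.toGroup u * g⁻¹ = φ.toGroup u
    rw [mul_inv_eq_iff_eq_mul, ← mul_inv_eq_iff_eq_mul.1 h1]
  · rintro h _ ⟨u, rfl⟩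
    have h1 : g * ψ.toGroup u * g⁻¹ = φ.toGroup u :=
      congrArg (fun χ : U ⟶ whole S => χ.toGroup u) h
    refine congrArg Biset.Regular.mk ?_
    change φ.toGroup u * g * (ψ.toGroup u)⁻¹ = g
    rw [← h1]
    simp

end DoubleBurnside

/-! ### Multiplicativity of `σ̃` -/

section SigmaTilde

open SubgroupObj DoubleBurnside

variable {G : Type u} [Group G] [Finite G] {S : DiagonalSystem G}

/-- Multiplying by `|G|` and `|C_G(φ(U))|` clears denominators. The sum over classes becomes a sum
over all `χ` with weight `|C_G(χ(U))|`, which is the denominator in the coefficient of `b`, and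
`card_mul_mark_mul` applies. -/
theorem coeffBar_mul {U : SubgroupObj S} [Fintype (HomBar U (whole S))] (a b : bisetSubring S)
    (p q : HomBar U (whole S)) :
    coeffBar (a * b) p q = ∑ r, coeffBar a p r * coeffBar b r q := by
  have _ : Fintype (U ⟶ whole S) := Fintype.ofFinite _
  induction p using Quotient.ind with | _ φ =>
  induction q using Quotient.ind with | _ ψ =>
  have hG : (Nat.card G : ℤ) ≠ 0 := by exact_mod_cast Nat.card_pos.ne'
  have hC : (Nat.card (Subgroup.centralizer (φ.toGroup.range : Set G)) : ℤ) ≠ 0 := by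
    exact_mod_cast Nat.card_pos.ne'
  apply mul_left_cancel₀ hG
  apply mul_right_cancel₀ hC
  rw [← sum_mul_card_centralizer, mul_assoc]
  change (Nat.card G : ℤ) * (coeff (a * b) φ ψ * _) = _
  rw [coeff_mul_card, Subring.coe_mul, card_mul_mark_mul φ ψ a.2 b.2, Finset.sum_mul]
  refine Finset.sum_congr rfl fun χ _ => ?_
  change _ = coeff a φ χ * coeff b χ ψ * _ * _
  rw [← coeff_mul_card, ← coeff_mul_card]
  ring

theorem coeffBar_one {U : SubgroupObj S} [DecidableEq (HomBar U (whole S))]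
    (p q : HomBar U (whole S)) : coeffBar (1 : bisetSubring S) p q = if p = q then 1 else 0 := by
  induction p using Quotient.ind with | _ φ =>
  induction q using Quotient.ind with | _ ψ =>
  have hC : (Nat.card (Subgroup.centralizer (φ.toGroup.range : Set G)) : ℤ) ≠ 0 := by
    exact_mod_cast Nat.card_pos.ne'
  apply mul_right_cancel₀ hC
  change coeff 1 φ ψ * _ = (if HomBar.mk φ = HomBar.mk ψ then (1 : ℤ) else 0) * _
  rw [coeff_mul_card, Subring.coe_one, mark_one]
  split_ifs with h
  · rw [one_mul, ← card_stabilizer]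
    obtain ⟨g, hg⟩ := mem_orbit_iff_mk_eq.2 h
    dsimp only at hg
    norm_cast
    -- The elements that carry `ψ` to `φ` form the right coset through `g` of the stabilizer of `φ`.
    refine Nat.card_congr ((Equiv.mulRight g⁻¹).subtypeEquiv fun k => ?_)
    rw [MulAction.mem_stabilizer_iff, Equiv.coe_mulRight, mul_smul, ← hg, inv_smul_smul]
  · have : IsEmpty {g : (whole S).toSubgroup // g • ψ = φ} :=
      ⟨fun g => h (mem_orbit_iff_mk_eq.1 ⟨g.1, g.2⟩)⟩
    simp

theorem sigmaLinear_apply (R : Type v) [CommRing R] (U : SubgroupObj S)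
    [Fintype (HomBar U (whole S))] (a : bisetSubring S) (x : HomBar U (whole S) →₀ R)
    (p : HomBar U (whole S)) :
    sigmaLinear R U a x p = ∑ q, (coeffBar a p q : R) * x q := by
  induction x using Finsupp.induction_linear with
  | zero => simp
  | add x y hx hy => simp [hx, hy, mul_add, Finset.sum_add_distrib]
  | single q r =>
    classical
    rw [← mul_one r, ← smul_eq_mul, ← Finsupp.smul_single, map_smul, Finsupp.smul_apply,
      sigmaLinear_single]
    simp [Finsupp.single_apply, mul_comm]

theorem sigmaLinear_mul (R : Type v) [CommRing R] (U : SubgroupObj S) (a b : bisetSubring S) :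
    sigmaLinear R U (a * b) = sigmaLinear R U a * sigmaLinear R U b := by
  have _ : Fintype (HomBar U (whole S)) := Fintype.ofFinite _
  refine Finsupp.lhom_ext' fun q => LinearMap.ext_ring ?_
  ext p
  change sigmaLinear R U (a * b) (Finsupp.single q 1) p =
    sigmaLinear R U a (sigmaLinear R U b (Finsupp.single q 1)) p
  rw [sigmaLinear_single, sigmaLinear_apply, coeffBar_mul, Int.cast_sum]
  exact Finset.sum_congr rfl fun r _ => by rw [sigmaLinear_single, Int.cast_mul]

theorem sigmaLinear_one (R : Type v) [CommRing R] (U : SubgroupObj S) :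
    sigmaLinear R U (1 : bisetSubring S) = 1 := by
  classical
  refine Finsupp.lhom_ext' fun q => LinearMap.ext_ring ?_
  ext p
  change sigmaLinear R U 1 (Finsupp.single q 1) p = Finsupp.single q (1 : R) p
  rw [sigmaLinear_single, coeffBar_one, Finsupp.single_apply]
  simp [eq_comm]

/-- The ring homomorphism `σ̃`, with coefficients in `R`. -/
def sigmaTildeRingHom (R : Type v) [CommRing R] (T : Set (SubgroupObj S)) :
    bisetSubring S →+* ((U : T) → EndOut R (U : SubgroupObj S)) where
  __ := sigmaTilde R T
  map_one' := funext fun U => Subtype.ext (sigmaLinear_one R U.1)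
  map_mul' a b := funext fun U => Subtype.ext (sigmaLinear_mul R U.1 a b)

end SigmaTilde

/-! ### Linear algebra: triangular matrices and adjugates -/

/-- The matrix is block triangular for the levels of `b`. The hypothesis also covers distinct
indices of equal level, so each diagonal block is itself diagonal. This avoids choosing a linear
order that refines `b`. -/
theorem Matrix.det_eq_prod_diag_of_forall_le {Q R : Type*} [Fintype Q] [DecidableEq Q] [CommRing R]
    (M : Matrix Q Q R) (b : Q → ℕ) (h : ∀ i j, i ≠ j → b j ≤ b i → M i j = 0) :
    M.det = ∏ i, M i i := by
  have hM : M.BlockTriangular b := fun i j hij => h i j (fun e => by simp [e] at hij) hij.le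
  have hblock : ∀ k, (M.toSquareBlock b k).det = ∏ i with b i = k, M i i := fun k => by
    have : M.toSquareBlock b k = Matrix.diagonal fun i => M i.1 i.1 := by
      ext i j
      rw [Matrix.diagonal_apply]
      split_ifs with e
      · rw [e]; rfl
      · exact h _ _ (fun e' => e (Subtype.ext e')) (i.2.trans j.2.symm).ge
    rw [this, Matrix.det_diagonal]
    exact (Finset.prod_subtype _ (by simp) fun i => M i i).symm
  rw [hM.det, Finset.prod_congr rfl fun k _ => hblock k]
  exact Finset.prod_fiberwise_of_maps_to (fun i _ => Finset.mem_image_of_mem b (Finset.mem_univ i)) _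

section LinearAlgebra

variable {R M N Q : Type*} [CommRing R] [AddCommGroup M] [Module R M] [AddCommGroup N] [Module R N]
  [Fintype Q] [DecidableEq Q] {β : (Q → R) →ₗ[R] M} {σ : M →ₗ[R] N} {γ : N →ₗ[R] Q → R}
  {A : Matrix Q Q R}

/-- If `A c = 0`, the adjugate gives `det A • c = 0`, hence `c = 0`. Only surjectivity of `β` is
required, so a spanning family suffices and its independence need not be known beforehand. -/
theorem injective_of_comp_eq_mulVec (hβ : Function.Surjective β)
    (h : ∀ c, γ (σ (β c)) = A.mulVec c) (hA : A.det ∈ nonZeroDivisors R) :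
    Function.Injective σ := by
  rw [injective_iff_map_eq_zero]
  intro x hx
  obtain ⟨c, rfl⟩ := hβ x
  have h1 : A.mulVec c = 0 := by rw [← h, hx, map_zero]
  have h2 : A.det • c = 0 := by
    rw [← Matrix.one_mulVec c, ← Matrix.smul_mulVec, ← Matrix.adjugate_mul, ← Matrix.mulVec_mulVec,
      h1, Matrix.mulVec_zero]
  have : c = 0 := funext fun q => (mul_left_mem_nonZeroDivisors_eq_zero_iff hA).1 (congrFun h2 q)
  rw [this, map_zero]

/-- The preimage is the image under `β` of the adjugate applied to `c`. Asking only for divisibility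
by the determinant serves both the finite index and the case of a unit determinant. -/
theorem mem_range_of_comp_eq_mulVec (hγ : Function.Injective γ)
    (h : ∀ c, γ (σ (β c)) = A.mulVec c) {y : N} {c : Q → R} (hy : γ y = A.det • c) :
    y ∈ LinearMap.range σ := by
  refine ⟨β (A.adjugate.mulVec c), hγ ?_⟩
  rw [h, hy, Matrix.mulVec_mulVec, Matrix.mul_adjugate, Matrix.smul_mulVec, Matrix.one_mulVec]

end LinearAlgebra

/-! ### Transitive bisets and conjugacy classes of `S` -/

namespace DoubleBurnside

variable {G : Type u} [Group G]

/-- The fixed points of `L` on its own cosets form `N(L) / L`, whose order divides `|G × G|`. -/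
theorem card_fix_self_dvd [Finite G] (L : Subgroup (G × G)) :
    Nat.card (Fix L ((G × G) ⧸ L)) ∣ Nat.card G ^ 2 := by
  have e : Nat.card (Fix L ((G × G) ⧸ L)) = Nat.card (MulAction.fixedPoints L ((G × G) ⧸ L)) :=
    Nat.card_congr (Equiv.subtypeEquivRight fun x =>
      ⟨fun h l => h l.1 l.2, fun h l hl => h ⟨l, hl⟩⟩)
  rw [e, Nat.card_congr (Sylow.fixedPointsMulLeftCosetsEquivQuotient L)]
  refine (Subgroup.card_quotient_dvd_card _).trans ((Subgroup.card_subgroup_dvd_card _).trans ?_)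
  rw [Nat.card_prod, sq]

theorem exists_le_conj_of_fix {L M : Subgroup (G × G)} (x : Fix L ((G × G) ⧸ M)) :
    ∃ a : G × G, L ≤ M.map (MulAut.conj a).toMonoidHom := by
  obtain ⟨x, hx⟩ := x
  obtain ⟨a, rfl⟩ := QuotientGroup.mk_surjective x
  refine ⟨a, fun l hl => ?_⟩
  have h := QuotientGroup.eq.1 (hx l hl).symm
  exact ⟨_, h, by simp [MulAut.conj_apply]⟩

/-- The conjugate of `L` by `a` is the stabilizer of the coset `a L`, and a transitive set is the
coset space of any of its stabilizers. -/
theorem cls_quotient_conj [Finite G] {L M : Subgroup (G × G)} {a : G × G}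
    (h : M = L.map (MulAut.conj a).toMonoidHom) :
    (cls ((G × G) ⧸ M) : DoubleBurnside G) = cls ((G × G) ⧸ L) := by
  let y : (G × G) ⧸ L := (a : G × G)
  have hs : MulAction.stabilizer (G × G) y = L.map (MulAut.conj a).toMonoidHom := by
    have : y = a • (((1 : G × G) : (G × G) ⧸ L)) := by
      rw [MulAction.Quotient.smul_coe]; simp [y]
    rw [this, MulAction.stabilizer_smul_eq_stabilizer_map_conj, MulAction.stabilizer_quotient]
  rw [← hs] at h
  subst h
  refine cls_eq_of_iso (Biset.Iso.of_bijective (MulAction.ofQuotientStabilizer (G × G) y)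
    (MulAction.injective_ofQuotientStabilizer _ _) ?_ fun g x => ?_)
  · intro z
    obtain ⟨g, hg⟩ := MulAction.exists_smul_eq (G × G) y z
    exact ⟨(g : G × G), hg⟩
  · obtain ⟨b, rfl⟩ := QuotientGroup.mk_surjective x
    exact mul_smul g b y

end DoubleBurnside

namespace DiagonalSystem

variable {G : Type u} [Group G]

/-- Conjugacy of elements of `S`. -/
def conjSetoid (S : DiagonalSystem G) : Setoid S.carrier where
  r L M := ∃ x : G × G, (M : Subgroup (G × G)) = L.1.map (MulAut.conj x).toMonoidHom
  iseqv := by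
    refine ⟨fun L => ⟨1, ?_⟩, ?_, ?_⟩
    · rw [map_one]
      exact (Subgroup.map_id L.1).symm
    · rintro L M ⟨x, hx⟩
      refine ⟨x⁻¹, ?_⟩
      rw [hx, Subgroup.map_map]
      convert (Subgroup.map_id L.1).symm
      ext <;> simp [mul_assoc]
    · rintro L M N ⟨x, hx⟩ ⟨y, hy⟩
      refine ⟨y * x, ?_⟩
      rw [hy, hx, Subgroup.map_map, map_mul]
      rfl

/-- The conjugacy classes of `S`. -/
def Class (S : DiagonalSystem G) : Type u := Quotient S.conjSetoid

instance [Finite G] (S : DiagonalSystem G) : Finite S.Class :=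
  inferInstanceAs (Finite (Quotient S.conjSetoid))

variable {S : DiagonalSystem G}

/-- A representative of a conjugacy class. -/
def Class.rep (q : S.Class) : Subgroup (G × G) := (Quotient.out (s := S.conjSetoid) q).1

theorem Class.rep_mem (q : S.Class) : q.rep ∈ S.carrier :=
  (Quotient.out (s := S.conjSetoid) q).2

theorem Class.eq_of_rep {q r : S.Class} {x : G × G}
    (h : r.rep = q.rep.map (MulAut.conj x).toMonoidHom) : q = r := by
  have : Quotient.mk S.conjSetoid (Quotient.out (s := S.conjSetoid) q) =
      Quotient.mk S.conjSetoid (Quotient.out (s := S.conjSetoid) r) := Quotient.sound ⟨x, h⟩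
  exact (Quotient.out_eq q).symm.trans (this.trans (Quotient.out_eq r))

theorem Class.exists_rep {L : Subgroup (G × G)} (hL : L ∈ S.carrier) :
    ∃ (q : S.Class) (x : G × G), q.rep = L.map (MulAut.conj x).toMonoidHom := by
  refine ⟨Quotient.mk S.conjSetoid ⟨L, hL⟩, ?_⟩
  exact S.conjSetoid.symm (Quotient.mk_out (s := S.conjSetoid) ⟨L, hL⟩)

variable [Finite G]

open DoubleBurnside

/-- The element `[G × G / L]` of `B^S(G,G)`, where `L` represents a conjugacy class of `S`. -/
def Class.basis (q : S.Class) : bisetSubring S :=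
  ⟨cls ((G × G) ⧸ q.rep), AddSubgroup.subset_closure ⟨_, q.rep_mem, rfl⟩⟩

/-- Triangularity of the table of marks: a fixed coset places `q.rep` inside a conjugate of `r.rep`,
and the comparison of orders turns the inclusion into an equality. -/
theorem Class.eq_of_mark_ne_zero {q r : S.Class} (h : mark q.rep (r.basis : DoubleBurnside G) ≠ 0)
    (hcard : Nat.card r.rep ≤ Nat.card q.rep) : q = r := by
  have h1 : Nat.card (Fix q.rep ((G × G) ⧸ r.rep)) ≠ 0 := fun e => h (by
    change mark q.rep (cls ((G × G) ⧸ r.rep)) = 0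
    rw [mark_cls, e, Nat.cast_zero])
  obtain ⟨⟨x⟩, -⟩ := Nat.card_ne_zero.1 h1
  obtain ⟨a, ha⟩ := exists_le_conj_of_fix x
  refine (Class.eq_of_rep (x := a) (Subgroup.eq_of_le_of_card_ge ha ?_)).symm
  rwa [Subgroup.card_map_of_injective (MulAut.conj a).injective]

theorem Class.mark_basis_self_dvd (q : S.Class) :
    mark q.rep (q.basis : DoubleBurnside G) ∣ (Nat.card G : ℤ) ^ 2 := by
  change mark q.rep (cls ((G × G) ⧸ q.rep)) ∣ _
  rw [mark_cls]
  exact_mod_cast card_fix_self_dvd q.rep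

theorem Class.exists_sum_smul_basis [Fintype S.Class] (a : bisetSubring S) :
    ∃ c : S.Class → ℤ, a = ∑ q, c q • q.basis := by
  classical
  obtain ⟨a, ha⟩ := a
  change a ∈ AddSubgroup.closure _ at ha
  suffices h : ∃ c : S.Class → ℤ, a = ∑ q, c q • (q.basis : DoubleBurnside G) by
    obtain ⟨c, rfl⟩ := h
    exact ⟨c, Subtype.ext (by simp)⟩
  induction ha using AddSubgroup.closure_induction with
  | zero => exact ⟨0, by simp⟩
  | add x y hx hy h1 h2 =>
    obtain ⟨c, rfl⟩ := h1
    obtain ⟨d, rfl⟩ := h2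
    exact ⟨c + d, by simp [add_smul, Finset.sum_add_distrib]⟩
  | neg x hx h =>
    obtain ⟨c, rfl⟩ := h
    exact ⟨-c, by simp⟩
  | mem x hx =>
    obtain ⟨L, hL, rfl⟩ := hx
    obtain ⟨q, x, hq⟩ := Class.exists_rep hL
    refine ⟨Pi.single q 1, ?_⟩
    rw [Finset.sum_eq_single q (fun r _ hr => by simp [hr]) (by simp), Pi.single_eq_same, one_smul]
    change _ = cls ((G × G) ⧸ q.rep)
    exact (cls_quotient_conj hq).symm

/-- The `R`-linear map that sends the indicator function of a conjugacy class to
the corresponding element of `R ⊗ B^S(G,G)`. -/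
def combination (S : DiagonalSystem G) [Fintype S.Class] (R : Type v) [CommRing R] :
    (S.Class → R) →ₗ[R] R ⊗[ℤ] bisetSubring S :=
  Fintype.linearCombination R fun q => 1 ⊗ₜ q.basis

theorem combination_surjective (S : DiagonalSystem G) [Fintype S.Class] (R : Type v) [CommRing R] :
    Function.Surjective (S.combination R) := by
  rw [← LinearMap.range_eq_top, eq_top_iff]
  rintro x -
  induction x using TensorProduct.induction_on with
  | zero => exact zero_mem _
  | add x y hx hy => exact add_mem hx hy
  | tmul r a =>
    obtain ⟨c, rfl⟩ := Class.exists_sum_smul_basis a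
    refine ⟨fun q => r * c q, ?_⟩
    rw [combination, Fintype.linearCombination_apply, TensorProduct.tmul_sum]
    refine Finset.sum_congr rfl fun q _ => ?_
    rw [TensorProduct.smul_tmul', smul_eq_mul, mul_one, ← TensorProduct.smul_tmul, zsmul_eq_mul,
      mul_comm]

end DiagonalSystem

/-! ### Members of `S` as pairs of morphisms to `G` -/

namespace SubgroupObj

variable {G : Type u} [Group G] {S : DiagonalSystem G}

/-- For `L = Δ(A, α, B)` the pair consists of `α` and the inclusion of `B`; it is then transported
along an isomorphism from a representative in `T`. Here `L` itself witnesses that `α` is a morphism.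
-/
theorem exists_pairSubgroup_eq {T : Set (SubgroupObj S)}
    (hT : ∀ V : SubgroupObj S, ∃ U ∈ T, Nonempty (U ≅ V)) {L : Subgroup (G × G)}
    (hL : L ∈ S.carrier) :
    ∃ (U : T) (φ ψ : (U : SubgroupObj S) ⟶ whole S), pairSubgroup φ.toGroup ψ.toGroup = L := by
  obtain ⟨A, B, α, rfl⟩ := S.twisted L hL
  let V : SubgroupObj S := ⟨B⟩
  obtain ⟨U, hU, ⟨e⟩⟩ := hT V
  let φ : V ⟶ whole S := ⟨(A.subtype.comp α.toMonoidHom).codRestrict ⊤ fun _ => trivial, hL⟩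
  let ψ : V ⟶ whole S := ⟨B.subtype.codRestrict ⊤ fun _ => trivial, pair_id_mem S B⟩
  refine ⟨⟨U, hU⟩, e.hom ≫ φ, e.hom ≫ ψ, ?_⟩
  have hs : Function.Surjective (Hom.toHom e.hom) := fun v =>
    ⟨Hom.toHom e.inv v, by rw [← comp_apply, e.inv_hom_id, id_apply]⟩
  ext x
  exact (hs.exists (p := fun v => (φ.toGroup v, ψ.toGroup v) = x)).symm

theorem toGroup_injective {U : SubgroupObj S} (φ : U ⟶ whole S) :
    Function.Injective φ.toGroup := fun _ _ h => Hom.injective φ (Subtype.ext h)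

/-- For symmetric `S`, a pair of morphisms to `G` factors through every pair with a larger
subgroup of `G × G`. -/
theorem exists_factorization (hS : S.IsSymmetric) {U V : SubgroupObj S} {φ ψ : U ⟶ whole S}
    {φ' ψ' : V ⟶ whole S}
    (h : pairSubgroup φ'.toGroup ψ'.toGroup ≤ pairSubgroup φ.toGroup ψ.toGroup) :
    ∃ α : V ⟶ U, α ≫ φ = φ' ∧ α ≫ ψ = ψ' := by
  choose f hf using fun v : V.toSubgroup =>
    (h ⟨v, rfl⟩ : ((φ'.toGroup v, ψ'.toGroup v) : G × G) ∈ pairSubgroup φ.toGroup ψ.toGroup)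
  have hf1 : ∀ v, φ.toGroup (f v) = φ'.toGroup v := fun v => congrArg Prod.fst (hf v)
  have hf2 : ∀ v, ψ.toGroup (f v) = ψ'.toGroup v := fun v => congrArg Prod.snd (hf v)
  refine ⟨⟨MonoidHom.mk' f fun a b => toGroup_injective φ (by simp only [map_mul, hf1]), ?_⟩,
    hom_ext fun v => Subtype.ext (hf1 v), hom_ext fun v => Subtype.ext (hf2 v)⟩
  -- The factor is `φ⁻¹ φ'`. Its graph lies in the `*`-product of the opposite of the graph of `φ`
  -- with the graph of `φ'`, which belongs to `S` by symmetry.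
  have hop : oppositeSubgroup (pairSubgroup φ.toGroup U.toSubgroup.subtype) ∈ S.carrier := by
    rw [← hS]
    exact ⟨_, φ.mem, rfl⟩
  refine S.subgroup_mem _ (S.star_mem _ hop _ φ'.mem) _ ?_
  rintro _ ⟨v, rfl⟩
  exact ⟨φ'.toGroup v, ⟨(φ.toGroup (f v), f v), ⟨f v, rfl⟩, Prod.ext rfl (hf1 v)⟩, ⟨v, rfl⟩⟩

theorem eq_id_of_comp_eq {U : SubgroupObj S} {φ : U ⟶ whole S} {α : U ⟶ U} (h : α ≫ φ = φ) :
    α = 𝟙 U :=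
  hom_ext fun u => Hom.injective φ (congrArg (fun χ : U ⟶ whole S => Hom.toHom χ u) h)

/-- Each pair factors through the other, and the two factors are mutually inverse because morphisms
to `G` are monomorphisms. -/
theorem exists_iso_of_pairSubgroup_eq (hS : S.IsSymmetric) {U V : SubgroupObj S}
    {φ ψ : U ⟶ whole S} {φ' ψ' : V ⟶ whole S}
    (h : pairSubgroup φ'.toGroup ψ'.toGroup = pairSubgroup φ.toGroup ψ.toGroup) :
    ∃ α : V ≅ U, α.hom ≫ φ = φ' ∧ α.hom ≫ ψ = ψ' := by
  obtain ⟨α, h1, h2⟩ := exists_factorization hS h.le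
  obtain ⟨β, h3, h4⟩ := exists_factorization hS h.ge
  refine ⟨⟨α, β, eq_id_of_comp_eq (φ := φ') ?_, eq_id_of_comp_eq (φ := φ) ?_⟩, h1, h2⟩
  · rw [Category.assoc, h3, h1]
  · rw [Category.assoc, h1, h3]

theorem pairSubgroup_smul {U : SubgroupObj S} (φ ψ : U ⟶ whole S) (v w : (whole S).toSubgroup) :
    pairSubgroup (Hom.toGroup (v • φ)) (Hom.toGroup (w • ψ)) =
      (pairSubgroup φ.toGroup ψ.toGroup).map (MulAut.conj ((v : G), (w : G))).toMonoidHom := by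
  have e : (Hom.toGroup (v • φ)).prod (Hom.toGroup (w • ψ)) =
      (MulAut.conj ((v : G), (w : G))).toMonoidHom.comp (φ.toGroup.prod ψ.toGroup) := rfl
  rw [pairSubgroup, pairSubgroup, e, MonoidHom.range_comp]

/-- The subgroup lies in the `*`-product of the graph of `φ` with the opposite of the graph of `ψ`.
Thus every matrix position belongs to some conjugacy class of `S`. -/
theorem pairSubgroup_mem (hS : S.IsSymmetric) {U : SubgroupObj S} (φ ψ : U ⟶ whole S) :
    pairSubgroup φ.toGroup ψ.toGroup ∈ S.carrier := by
  have hop : oppositeSubgroup (pairSubgroup ψ.toGroup U.toSubgroup.subtype) ∈ S.carrier := by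
    rw [← hS]
    exact ⟨_, ψ.mem, rfl⟩
  refine S.subgroup_mem _ (S.star_mem _ φ.mem _ hop) _ ?_
  rintro _ ⟨u, rfl⟩
  exact ⟨u, ⟨u, rfl⟩, ⟨(ψ.toGroup u, u), ⟨u, rfl⟩, rfl⟩⟩

/-- The matrix entries of an endomorphism that commutes with the group are constant on orbits. -/
theorem EndOut.entry_smul {R : Type v} [CommRing R] {U : SubgroupObj S} (f : EndOut R U)
    (x : (OutGroup U)ᵐᵒᵖ) (p q : HomBar U (whole S)) :
    f.1 (Finsupp.single (x • q) 1) (x • p) =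
      f.1 (Finsupp.single q 1) p := by
  have h := LinearMap.congr_fun ((Subalgebra.mem_centralizer_iff R).1 f.2 _ ⟨x, rfl⟩)
    (Finsupp.single q 1)
  have h' : Finsupp.mapDomain (x • ·) (f.1 (Finsupp.single q 1)) =
    f.1 (Finsupp.mapDomain (x • ·) (Finsupp.single q 1)) := h
  rw [Finsupp.mapDomain_single] at h'
  rw [← h', Finsupp.mapDomain_apply (MulAction.injective x)]

end SubgroupObj

/-! ### The matrix of `σ̃`: injectivity, finite index and surjectivity -/

section SigmaTilde

open SubgroupObj DoubleBurnside DiagonalSystem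

variable {G : Type u} [Group G] {S : DiagonalSystem G} {T : Set (SubgroupObj S)}
  (R : Type v) [CommRing R] {U : S.Class → T}
  (φ ψ : ∀ q, (U q : SubgroupObj S) ⟶ whole S)

/-- The matrix entries of a family of endomorphisms at the classes of the morphisms
`φ q` and `ψ q`. -/
def entries : ((V : T) → EndOut R (V : SubgroupObj S)) →ₗ[R] S.Class → R where
  toFun f q := (f (U q)).1 (Finsupp.single (HomBar.mk (ψ q)) 1) (HomBar.mk (φ q))
  map_add' _ _ := rfl
  map_smul' _ _ := rfl

variable {φ ψ}

/-- Once `V` and `W` are identified, `α` is an automorphism and the two entries lie in one orbit of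
`Out`. Keeping the equality as a separate hypothesis allows this substitution with `α` still
arbitrary. -/
theorem entry_eq_zero_of_class {V W : T} (h : V = W) {f : (V : T) → EndOut R (V : SubgroupObj S)}
    {χ ω : (V : SubgroupObj S) ⟶ whole S} (α : (V : SubgroupObj S) ≅ W)
    {χ' ω' : (W : SubgroupObj S) ⟶ whole S} (hχ : HomBar.mk (α.hom ≫ χ') = HomBar.mk χ)
    (hω : HomBar.mk (α.hom ≫ ω') = HomBar.mk ω)
    (h0 : (f W).1 (Finsupp.single (HomBar.mk ω') 1) (HomBar.mk χ') = 0) :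
    (f V).1 (Finsupp.single (HomBar.mk ω) 1) (HomBar.mk χ) = 0 := by
  subst h
  rw [← h0, ← hχ, ← hω]
  let β : Aut V.1 := α
  exact EndOut.entry_smul (f V) (MulOpposite.op (β : OutGroup V.1)) (HomBar.mk χ') (HomBar.mk ω')

/-- A position `([χ], [ω])` defines a member of `S`, conjugate to some `q.rep`. Conjugation does not
change the classes of `χ` and `ω`, and pairs with equal subgroups differ by an isomorphism, so
equivariance forces the entry to vanish with the entry at `q`. -/
theorem entries_injective (hS : S.IsSymmetric)
    (hT : ∀ V : SubgroupObj S, ∃! W : SubgroupObj S, W ∈ T ∧ Nonempty (W ≅ V))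
    (hrep : ∀ q, pairSubgroup (φ q).toGroup (ψ q).toGroup = q.rep) :
    Function.Injective (entries R φ ψ) := by
  rw [injective_iff_map_eq_zero]
  intro f hf
  funext V
  refine Subtype.ext (Finsupp.lhom_ext' fun p => LinearMap.ext_ring ?_)
  ext p'
  induction p using Quotient.ind with | _ ω =>
  induction p' using Quotient.ind with | _ χ =>
  obtain ⟨q, ⟨x, y⟩, hq⟩ := Class.exists_rep (pairSubgroup_mem hS χ ω)
  let v : (whole S).toSubgroup := ⟨x, trivial⟩
  let w : (whole S).toSubgroup := ⟨y, trivial⟩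
  obtain ⟨α, h1, h2⟩ := exists_iso_of_pairSubgroup_eq hS
    (((pairSubgroup_smul χ ω v w).trans hq.symm).trans (hrep q).symm)
  -- Isomorphic members of `T` coincide; this is where uniqueness of representatives enters.
  have hV : V = U q := Subtype.ext ((hT (U q)).unique ⟨V.2, ⟨α⟩⟩ ⟨(U q).2, ⟨Iso.refl _⟩⟩)
  refine entry_eq_zero_of_class R hV α (χ' := φ q) (ω' := ψ q) ?_ ?_ (congrFun hf q)
  · rw [h1]
    exact mem_orbit_iff_mk_eq.1 ⟨v, rfl⟩
  · rw [h2]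
    exact mem_orbit_iff_mk_eq.1 ⟨w, rfl⟩

variable [Finite G]

variable (φ ψ) in
/-- The matrix of `σ̃` with respect to the classes `[G × G / L]` and the entries at the
classes of `φ q` and `ψ q`. -/
def coeffMatrix : Matrix S.Class S.Class ℤ := fun q r => coeff r.basis (φ q) (ψ q)

/-- Multiplying row `q` by the order of the centralizer of the image of `φ q` gives the table of
marks. The two matrices have the same zeros off the diagonal, and diagonal coefficients divide
diagonal marks. -/
theorem det_coeffMatrix_dvd [Fintype S.Class] [DecidableEq S.Class]
    (hrep : ∀ q, pairSubgroup (φ q).toGroup (ψ q).toGroup = q.rep) :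
    ∃ n, (coeffMatrix φ ψ).det ∣ (Nat.card G : ℤ) ^ n := by
  have hmul : ∀ q r, coeffMatrix φ ψ q r *
      (Nat.card (Subgroup.centralizer ((φ q).toGroup.range : Set G)) : ℤ) =
      mark q.rep (r.basis : DoubleBurnside G) := fun q r => by
    rw [← hrep]
    exact coeff_mul_card _ _ _
  rw [Matrix.det_eq_prod_diag_of_forall_le _ fun q => Nat.card q.rep]
  -- Each diagonal entry contributes one factor `|G|²`.
  · refine ⟨2 * Fintype.card S.Class, ?_⟩
    rw [pow_mul, ← Finset.card_univ, ← Finset.prod_const]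
    refine Finset.prod_dvd_prod_of_dvd _ _ fun q _ => ?_
    exact (Dvd.intro _ (hmul q q)).trans q.mark_basis_self_dvd
  · intro q r hne hcard
    have h0 : mark q.rep (r.basis : DoubleBurnside G) = 0 :=
      by_contra fun h => hne (Class.eq_of_mark_ne_zero h hcard)
    rw [← hmul] at h0
    exact (mul_eq_zero.1 h0).resolve_right (by exact_mod_cast Nat.card_pos.ne')

theorem entries_sigmaTildeBaseChange [Fintype S.Class] (c : S.Class → R) :
    entries R φ ψ (sigmaTildeBaseChange R T (S.combination R c)) =
      ((coeffMatrix φ ψ).map (Int.castRingHom R)).mulVec c := by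
  funext q
  rw [combination, Fintype.linearCombination_apply, map_sum, map_sum, Finset.sum_apply]
  refine Finset.sum_congr rfl fun r _ => ?_
  rw [map_smul, map_smul, sigmaTildeBaseChange, LinearMap.liftBaseChange_tmul, one_smul,
    Pi.smul_apply, smul_eq_mul, mul_comm]
  exact congrArg (· * c r)
    (sigmaLinear_single R (U q).1 r.basis (HomBar.mk (φ q)) (HomBar.mk (ψ q)))

theorem sigmaTildeBaseChange_injective
    (hT : ∀ V : SubgroupObj S, ∃ W ∈ T, Nonempty (W ≅ V))
    (hG : (Nat.card G : R) ∈ nonZeroDivisors R) :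
    Function.Injective (sigmaTildeBaseChange R T) := by
  classical
  have _ : Fintype S.Class := Fintype.ofFinite _
  choose U φ ψ hrep using fun q : S.Class => exists_pairSubgroup_eq hT q.rep_mem
  refine injective_of_comp_eq_mulVec (combination_surjective S R)
    (entries_sigmaTildeBaseChange R (φ := φ) (ψ := ψ)) ?_
  obtain ⟨n, d, hd⟩ := det_coeffMatrix_dvd hrep
  have hd' := congrArg (Int.castRingHom R) hd
  rw [map_mul, map_pow, map_natCast] at hd'
  rw [← RingHom.mapMatrix_apply, ← RingHom.map_det]
  exact (mul_mem_nonZeroDivisors.1 (hd' ▸ pow_mem hG n)).1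

theorem sigmaTildeBaseChange_surjective (hS : S.IsSymmetric)
    (hT : ∀ V : SubgroupObj S, ∃! W : SubgroupObj S, W ∈ T ∧ Nonempty (W ≅ V))
    (hG : IsUnit (Nat.card G : R)) : Function.Surjective (sigmaTildeBaseChange R T) := by
  classical
  have _ : Fintype S.Class := Fintype.ofFinite _
  choose U φ ψ hrep using fun q : S.Class => exists_pairSubgroup_eq (fun V => (hT V).exists) q.rep_mem
  obtain ⟨n, d, hd⟩ := det_coeffMatrix_dvd hrep
  have hd' := congrArg (Int.castRingHom R) hd
  rw [map_mul, map_pow, map_natCast, RingHom.map_det, RingHom.mapMatrix_apply] at hd'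
  -- The determinant divides a power of the unit `|G|`, so it is a unit, and every vector of entries
  -- is a multiple of it.
  obtain ⟨u, hu⟩ := isUnit_of_mul_isUnit_left (hd' ▸ hG.pow n)
  intro y
  refine mem_range_of_comp_eq_mulVec (entries_injective R hS hT hrep)
    (entries_sigmaTildeBaseChange R) (c := (↑u⁻¹ : R) • entries R φ ψ y) ?_
  rw [← hu, smul_smul, Units.mul_inv, one_smul]

theorem sigmaTildeBaseChange_one_tmul (a : bisetSubring S) :
    sigmaTildeBaseChange R T (1 ⊗ₜ a) = sigmaTilde R T a := by
  rw [sigmaTildeBaseChange, LinearMap.liftBaseChange_tmul, one_smul]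
  rfl

theorem sigmaTilde_injective (hT : ∀ V : SubgroupObj S, ∃ W ∈ T, Nonempty (W ≅ V)) :
    Function.Injective (sigmaTilde ℤ T) := by
  intro a b h
  rw [← sigmaTildeBaseChange_one_tmul, ← sigmaTildeBaseChange_one_tmul] at h
  have hG : ((Nat.card G : ℕ) : ℤ) ∈ nonZeroDivisors ℤ :=
    mem_nonZeroDivisors_of_ne_zero (by exact_mod_cast Nat.card_pos.ne')
  have := congrArg (TensorProduct.lid ℤ (bisetSubring S))
    (sigmaTildeBaseChange_injective ℤ hT hG h)
  simpa using this

/-- The families whose entries are all divisible by the determinant form the kernel of a map to a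
finite group, and the adjugate argument places this kernel in the range. -/
theorem sigmaTilde_range_finiteIndex (hS : S.IsSymmetric)
    (hT : ∀ V : SubgroupObj S, ∃! W : SubgroupObj S, W ∈ T ∧ Nonempty (W ≅ V)) :
    (sigmaTilde ℤ T).range.FiniteIndex := by
  classical
  have _ : Fintype S.Class := Fintype.ofFinite _
  choose U φ ψ hrep using fun q : S.Class => exists_pairSubgroup_eq (fun V => (hT V).exists) q.rep_mem
  set A := (coeffMatrix φ ψ).map (Int.castRingHom ℤ) with hA
  have hdet : A.det.natAbs ≠ 0 := by
    obtain ⟨n, d, hd⟩ := det_coeffMatrix_dvd hrep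
    rw [Int.natAbs_ne_zero, hA, ← RingHom.mapMatrix_apply, ← RingHom.map_det]
    intro h0
    change (coeffMatrix φ ψ).det = 0 at h0
    rw [h0, zero_mul] at hd
    exact pow_ne_zero n (by exact_mod_cast Nat.card_pos.ne') hd
  -- A nonzero modulus makes `ZMod A.det.natAbs` finite, hence also the target of `reduce`.
  have _ : NeZero A.det.natAbs := ⟨hdet⟩
  let reduce : ((V : T) → EndOut ℤ (V : SubgroupObj S)) →+ (S.Class → ZMod A.det.natAbs) :=
    ((Int.castAddHom (ZMod A.det.natAbs)).compLeft S.Class).comp (entries ℤ φ ψ).toAddMonoidHom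
  have _ : reduce.ker.FiniteIndex := AddSubgroup.finiteIndex_ker reduce
  refine AddSubgroup.finiteIndex_of_le (H := reduce.ker) fun y hy => ?_
  have hdvd : ∀ q, A.det ∣ entries ℤ φ ψ y q := fun q => by
    have h0 : ((entries ℤ φ ψ y q : ℤ) : ZMod A.det.natAbs) = 0 := congrFun hy q
    exact Int.natAbs_dvd.1 ((ZMod.intCast_zmod_eq_zero_iff_dvd _ _).1 h0)
  choose c hc using hdvd
  obtain ⟨x, rfl⟩ := mem_range_of_comp_eq_mulVec (entries_injective ℤ hS hT hrep)
    (entries_sigmaTildeBaseChange ℤ) (c := c) (funext hc)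
  obtain ⟨a, rfl⟩ := (TensorProduct.lid ℤ (bisetSubring S)).symm.surjective x
  exact ⟨a, (sigmaTildeBaseChange_one_tmul ℤ a).symm⟩

theorem sigmaTildeBaseChange_one :
    sigmaTildeBaseChange R T (1 : R ⊗[ℤ] bisetSubring S) = 1 :=
  (sigmaTildeBaseChange_one_tmul R 1).trans (map_one (sigmaTildeRingHom R T))

theorem sigmaTildeBaseChange_mul (x y : R ⊗[ℤ] bisetSubring S) :
    sigmaTildeBaseChange R T (x * y) = sigmaTildeBaseChange R T x * sigmaTildeBaseChange R T y := by
  induction x using TensorProduct.induction_on with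
  | zero => rw [zero_mul, map_zero, zero_mul]
  | add x x' hx hx' => rw [add_mul, map_add, map_add, hx, hx', add_mul]
  | tmul r a =>
    induction y using TensorProduct.induction_on with
    | zero => rw [mul_zero, map_zero, mul_zero]
    | add y y' hy hy' => rw [mul_add, map_add, map_add, hy, hy', mul_add]
    | tmul s b =>
      have hmul : sigmaTilde R T (a * b) = sigmaTilde R T a * sigmaTilde R T b :=
        map_mul (sigmaTildeRingHom R T) a b
      have htmul : ∀ (t : R) (c : bisetSubring S),
          sigmaTildeBaseChange R T (t ⊗ₜ c) = t • sigmaTilde R T c := fun t c => by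
        rw [sigmaTildeBaseChange, LinearMap.liftBaseChange_tmul]
        rfl
      rw [Algebra.TensorProduct.tmul_mul_tmul, htmul, htmul, htmul, hmul, smul_mul_smul_comm]

end SigmaTilde

end

theorem theorem5p6 {G : Type u} [Group G] [Finite G] (S : DiagonalSystem G)
    (T : Set (SubgroupObj S))
    (hT : ∀ V : SubgroupObj S, ∃! U : SubgroupObj S, U ∈ T ∧ Nonempty (U ≅ V)) :
    ((∃ f : bisetSubring S →+* ((U : T) → SubgroupObj.EndOut ℤ (U : SubgroupObj S)),
        ∀ a, f a = sigmaTilde ℤ T a) ∧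
      Function.Injective (sigmaTilde ℤ T) ∧
      (S.IsSymmetric → (sigmaTilde ℤ T).range.FiniteIndex)) ∧
    ∀ (R : Type v) [CommRing R], S.IsSymmetric → IsUnit (Nat.card G : R) →
      ∃ e : (R ⊗[ℤ] bisetSubring S) ≃ₐ[R]
          ((U : T) → SubgroupObj.EndOut R (U : SubgroupObj S)),
        ∀ x, e x = sigmaTildeBaseChange R T x := by
  refine ⟨⟨⟨sigmaTildeRingHom ℤ T, fun _ => rfl⟩, sigmaTilde_injective fun V => (hT V).exists,
    fun hS => sigmaTilde_range_finiteIndex hS hT⟩, fun R _ hS hR => ?_⟩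
  exact ⟨AlgEquiv.ofLinearEquiv (LinearEquiv.ofBijective (sigmaTildeBaseChange R T)
    ⟨sigmaTildeBaseChange_injective R (fun V => (hT V).exists) hR.mem_nonZeroDivisors,
      sigmaTildeBaseChange_surjective R hS hT hR⟩)
    (sigmaTildeBaseChange_one R) (sigmaTildeBaseChange_mul R), fun _ => rfl⟩
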